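/- **Setting.** Let $F$ be a CNF formula with finite variable set $V$, that is, a finite set of clauses, each a finite set of literals $v$, $\neg v$ ($v\in V$); let $\mathrm{Lit}(F)$ be the set of all these literals. A *symmetry* of $F$ is a permutation of $\mathrm{Lit}(F)$ that commutes with negation and maps the set of clauses to itself; $\mathrm{Aut}(F)$ is the group of symmetries. The *model graph* $G(F)=(G,\pi)$ has as vertices the literals (color $0$) and the clauses (color $1$); each literal is adjacent to its negation and to the clauses containing it. For a vertex-colored graph $(G,\pi)$, $\mathrm{IR}((G,\pi),v)$ is the coloring obtained by giving $v$ a new color of its own and then running color refinement (repeatedly recoloring each vertex by its color and the multiset of colors of its neighbors) until the color partition is stable; $\mathrm{IR}((G,\pi),\epsilon)$ is color refinement alone. $(G,\pi)$ is *Tinhofer* if for every vertex $v$ the orbits of the stabilizer $\mathrm{Aut}(G,\pi)_v$ are exactly the color classes of $\pi'=\mathrm{IR}((G,\pi),v)$, and the same holds recursively for $(G,\pi')$. A *disjoint direct decomposition* of $F$ is a partition of $\mathrm{Lit}(F)$ into parts $L_1,\dots,L_k$ such that $\mathrm{Aut}(F)=A_1\times\dots\times A_k$ for subgroups $A_i$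 where $A_i$ only moves literals in $L_i$; the parts of the finest one are the *disjoint direct factors*. Write $[n]=\{1,\dots,n\}$; $\mathcal J_n$ is $\mathrm{Sym}(n)$ acting on $\binom{[n]}{2}$. $F$ *exhibits a Johnson symmetry $\mathcal J_n$ on $\sigma\subseteq\mathrm{Lit}(F)$ via $b$* if $\sigma$ is an orbit of $\mathrm{Aut}(F)$, $\sigma\cup\neg\sigma$ is a disjoint direct factor, $b\colon\sigma\to\binom{[n]}{2}$ is a bijection, and the permutation group that $\mathrm{Aut}(F)$ induces on $\sigma$ corresponds under $b$ to $\mathcal J_n$. For a permutation $\varphi$ of $\mathrm{Lit}(F)$, $\mathrm{expand}_F(\varphi)$ maps $l$ to $\varphi(l)$ if $\varphi(l)\ne l$, otherwise to $\neg\varphi(\neg l)$ if $\varphi(\neg l)\neq\neg l$, and otherwise to $l$. For a bijection $b:\sigma\to\binom{[n]}2$ and $\tau\in\mathrm{Sym}(n)$, the permutation of $\sigma$ *induced by $\tau$ via $b$* maps the literal with label set $\{i,j\}$ to the one with label set $\{\tau(i),\tau(j)\}$ (and all literals outside $\sigma$ are fixed). **Algorithm DetectJohnson**, on input $F$ and $\sigma\subseteq\mathrm{Lit}(F)$.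 All choices are arbitrary; a failing check returns $\bot$. The fragments of $\sigma$ in a coloring are the nonempty intersections of $\sigma$ with color classes. 1. Let $(G,\pi)=G(F)$, $\pi'=\mathrm{IR}((G,\pi),\epsilon)$. Check that $|\sigma|\ge 28$ and $|\sigma|=\binom n2$ for some $n$. Set $\mathrm{label}[v]=[\,]$ and $\mathrm{ad}[v]=\emptyset$ for all $v$, and $\mathrm{vnr}=1$. 2. While some $v\in\sigma$ has $|\mathrm{label}[v]|\le1$: - Choose such a $v$. *Explore* $v$: check that $\sigma$ has exactly $3$ fragments in $\pi_v=\mathrm{IR}((G,\pi'),v)$, and add to $\mathrm{ad}[v]$ the elements of the smaller non-singleton fragment. - Choose $w\in\mathrm{ad}[v]$ and explore $w$ in the same way. Let $\{y\}$ be the unique singleton fragment of $\sigma$ in $\mathrm{IR}((G,\pi_v),w)$ other than $\{v\},\{w\}$ (return $\bot$ if there is no unique one), and explore $y$. - Put $E_i=\{v,y\}\cup((\mathrm{ad}[v]\cap\mathrm{ad}[y])\setminus\{w\})$, $E_j=\{v,w\}\cup((\mathrm{ad}[v]\cap\mathrm{ad}[w])\setminus\{y\})$, $E_k=\{w,y\}\cup((\mathrm{ad}[w]\cap\mathrm{ad}[y])\setminus\{v\})$.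 For $E=E_i,E_j,E_k$ in turn: if the lists $\mathrm{label}[x]$, $x\in E$, have no common entry, append $\mathrm{vnr}$ to $\mathrm{label}[x]$ for all $x\in E$ and increase $\mathrm{vnr}$ by $1$. Check that some label was added in this iteration. 3. Check that $\mathrm{label}$ induces a bijection $\sigma\to\binom{[n]}2$ and that for each $i\in[n-1]$, $\mathrm{expand}_F(\beta)$ is a symmetry of $F$, where $\beta$ is the permutation of $\sigma$ induced by the transposition $(i,i+1)$ via $\mathrm{label}$. Return $\mathrm{label}$. **Theorem.** Let $F$ be a CNF formula and $\sigma\subseteq\mathrm{Lit}(F)$. For all choices made in the algorithm: 1. Suppose $\sigma\cap\neg\sigma=\emptyset$. If DetectJohnson returns $\mathrm{label}$, then, for the $n$ with $|\sigma|=\binom n2$, $\mathrm{label}$ is a bijective labeling of $\sigma$ by the $2$-subsets of $[n]$, and for every $\tau\in\mathrm{Sym}(n)$ the map $\mathrm{expand}_F(\beta)$ is a symmetry of $F$, where $\beta$ is the permutation of $\sigma$ induced by $\tau$ via $\mathrm{label}$. 2. Suppose $F$ exhibits a Johnson symmetry $\mathcal J_n$ with $n\ge8$ on $\sigma$ via $b$,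 and $G(F)$ is Tinhofer. Then DetectJohnson terminates and returns a labeling $\mathrm{label}$ for which there is $\tau\in\mathrm{Sym}(n)$ such that for all $v\in\sigma$ with $b(v)=\{i,j\}$, the entries of $\mathrm{label}[v]$ form the set $\{\tau(i),\tau(j)\}$. -/

import Mathlib

namespace JohnsonSym

open scoped Classical

universe u

noncomputable section

/-! ### CNF formulas and their symmetries -/

/-- A literal over the variable set `V`: `(v, true)` is `v` and `(v, false)` is `¬ v`. -/
abbrev Lit (V : Type u) : Type u := V × Bool

/-- The negation of a literal. -/
def neg {V : Type u} (l : Lit V) : Lit V := (l.1, !l.2)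

/-- A CNF formula with variable set `V`: a finite set of clauses, each a finite set of literals. -/
abbrev Formula (V : Type u) : Type u := Finset (Finset (Lit V))

/-- The map `f` on literals is a symmetry of `F`: it is a permutation of the literals that
commutes with negation and maps the set of clauses to itself. -/
def IsSymmetry {V : Type u} (F : Formula V) (f : Lit V → Lit V) : Prop :=
  Function.Bijective f ∧ (∀ l, f (neg l) = neg (f l)) ∧ F.image (fun C => C.image f) = F

/-- The group `Aut(F)` of symmetries of `F`. -/
def Aut {V : Type u} (F : Formula V) : Subgroup (Equiv.Perm (Lit V)) where
  carrier := {g | IsSymmetry F g}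
  one_mem' := by
    refine ⟨Function.bijective_id, fun _ => rfl, ?_⟩
    simp
  mul_mem' := by
    rintro g h ⟨_, hg, hgF⟩ ⟨_, hh, hhF⟩
    refine ⟨(g * h).bijective, fun l => by simp [hg, hh], ?_⟩
    conv_rhs => rw [← hgF, ← hhF]
    rw [Finset.image_image]
    congr 1
    funext C
    simp [Finset.image_image, Equiv.Perm.coe_mul]
  inv_mem' := by
    rintro g ⟨_, hg, hgF⟩
    refine ⟨(g⁻¹).bijective, fun l => ?_, ?_⟩
    · apply g.injective
      simp [hg]
    · conv_lhs => rw [← hgF]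
      rw [Finset.image_image]
      have : ((fun C : Finset (Lit V) => C.image (g⁻¹ : Equiv.Perm (Lit V))) ∘
          fun C : Finset (Lit V) => C.image g) = id := by
        funext C
        have h : (⇑g⁻¹ ∘ ⇑g) = id := funext fun x => by simp
        simp only [Function.comp_apply, Finset.image_image, h, Finset.image_id, id]
      rw [this, Finset.image_id]

/-! ### Individualization-refinement on vertex-colored graphs -/

/-- The automorphism group `Aut(G, π)` of a vertex-colored graph. -/
def colorAut {U : Type u} (G : SimpleGraph U) (π : U → ℕ) : Subgroup (Equiv.Perm U) where
  carrier := {g | (∀ x y, G.Adj (g x) (g y) ↔ G.Adj x y) ∧ ∀ x, π (g x) = π x}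
  one_mem' := ⟨fun _ _ => Iff.rfl, fun _ => rfl⟩
  mul_mem' := by
    rintro g h ⟨hg, hg'⟩ ⟨hh, hh'⟩
    exact ⟨fun x y => by simp [hg, hh], fun x => by simp [hg', hh']⟩
  inv_mem' := by
    rintro g ⟨hg, hg'⟩
    exact ⟨fun x y => by simpa using (hg (g⁻¹ x) (g⁻¹ y)).symm,
      fun x => by simpa using (hg' (g⁻¹ x)).symm⟩

/-- The former color of `x` together with the multiset of colors of its neighbors
(encoded as a sorted list). -/
def signature {U : Type u} [Fintype U] (G : SimpleGraph U) (π : U → ℕ) (x : U) : ℕ ×ₗ List ℕ :=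
  toLex (π x, (((Finset.univ.filter fun y => G.Adj x y).val.map π).sort (· ≤ ·)))

/-- One round of color refinement: every vertex is recolored according to its signature, the
new colors being the ranks of the signatures that occur (so two vertices get the same new color
exactly if they have the same signature). -/
def refineStep {U : Type u} [Fintype U] (G : SimpleGraph U) (π : U → ℕ) (x : U) : ℕ :=
  ((Finset.univ.image (signature G π)).filter fun t => t < signature G π x).card

/-- Color refinement, i.e. `IR((G, π), ε)`. The number of colors grows in every round until the
color partition is stable, so that it is stable after `|U|` rounds. -/
def colorRefine {U : Type u} [Fintype U] (G : SimpleGraph U) (π : U → ℕ) : U → ℕ :=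
  (refineStep G)^[Fintype.card U] π

/-- The vertex `v` obtains a new color, distinct from all others. -/
def individualize {U : Type u} (π : U → ℕ) (v : U) : U → ℕ :=
  fun x => if x = v then 0 else π x + 1

/-- `IR((G, π), v)`: individualize `v`, then run color refinement. -/
def IR {U : Type u} [Fintype U] (G : SimpleGraph U) (π : U → ℕ) (v : U) : U → ℕ :=
  colorRefine G (individualize π v)

/-- For every vertex `v`, the orbits of the stabilizer `Aut(G, π)_v` are exactly the color
classes of `IR((G, π), v)`. -/
def OrbitsAreColors {U : Type u} [Fintype U] (G : SimpleGraph U) (π : U → ℕ) : Prop :=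
  ∀ v x y : U, (∃ g ∈ colorAut G π, g v = v ∧ g x = y) ↔ IR G π v x = IR G π v y

/-- `(G, π)` is Tinhofer: orbits and colors coincide after individualizing any vertex, and the
same holds recursively for the colored graphs obtained by individualizing any vertices
`v₁, …, vₖ` one after another. -/
def IsTinhofer {U : Type u} [Fintype U] (G : SimpleGraph U) (π : U → ℕ) : Prop :=
  ∀ vs : List U, OrbitsAreColors G (vs.foldl (IR G) π)

/-! ### The model graph -/

/-- The vertices of the model graph of `F`: the literals and the clauses. -/
abbrev Vertex {V : Type u} (F : Formula V) : Type u := Lit V ⊕ {C : Finset (Lit V) // C ∈ F}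

/-- The adjacency relation of the model graph. -/
def modelAdj {V : Type u} (F : Formula V) : Vertex F → Vertex F → Prop
  | .inl a, .inl b => b = neg a
  | .inl a, .inr C => a ∈ C.1
  | .inr C, .inl a => a ∈ C.1
  | .inr _, .inr _ => False

/-- The model graph: a literal is joined to its negation and to the clauses containing it. -/
def modelGraph {V : Type u} (F : Formula V) : SimpleGraph (Vertex F) where
  Adj := modelAdj F
  symm := ⟨by
    rintro (a | C) (b | D) h
    · simp only [modelAdj] at h ⊢
      simp [h, neg]
    · exact h
    · exact h
    · exact h⟩
  loopless := ⟨by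
    rintro (⟨v, b⟩ | C) h
    · cases b <;> simp [modelAdj, neg] at h
    · exact h⟩

/-- The coloring of the model graph: literals get color `0`, clauses get color `1`. -/
def modelColoring {V : Type u} (F : Formula V) : Vertex F → ℕ
  | .inl _ => 0
  | .inr _ => 1

/-! ### Disjoint direct decompositions and Johnson symmetry -/

/-- The partition `P` of the literals is a disjoint direct decomposition: `Aut(F)` is the
product of subgroups `A c`, one for each class `c` of `P`, such that `A c` only moves literals
in `c`. (As the supports are pairwise disjoint, the subgroups commute and are independent, so the
product is direct.) -/
def IsDisjointDirectDecomposition {V : Type u} (F : Formula V) (P : Setoid (Lit V)) : Prop :=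
  ∃ A : Quotient P → Subgroup (Equiv.Perm (Lit V)),
    (∀ c, ∀ g ∈ A c, ∀ l : Lit V, Quotient.mk P l ≠ c → g l = l) ∧ ⨆ c, A c = Aut F

/-- `L` is a disjoint direct factor of `F`: a class of the finest disjoint direct
decomposition. -/
def IsDisjointDirectFactor {V : Type u} (F : Formula V) (L : Set (Lit V)) : Prop :=
  ∃ P : Setoid (Lit V), IsLeast {Q | IsDisjointDirectDecomposition F Q} P ∧ L ∈ P.classes

/-- `Sym(n)`, as the group of permutations of `ℕ` that fix everything outside
`[n] = {1, …, n}`. -/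
def symGroup (n : ℕ) : Subgroup (Equiv.Perm ℕ) where
  carrier := {τ | ∀ k, k ∉ Finset.Icc 1 n → τ k = k}
  one_mem' := fun _ _ => rfl
  mul_mem' := by
    intro g h hg hh k hk
    simp [hh k hk, hg k hk]
  inv_mem' := by
    intro g hg k hk
    exact Equiv.Perm.inv_eq_iff_eq.mpr (hg k hk).symm

/-- The `2`-subsets of `[n] = {1, …, n}`. -/
def twoSubsets (n : ℕ) : Finset (Finset ℕ) := (Finset.Icc 1 n).powersetCard 2

/-- `F` exhibits a Johnson symmetry with Johnson group `J_n` on `σ`, via the labeling `b` of the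
literals in `σ` by the `2`-subsets of `[n]`. -/
structure ExhibitsJohnson {V : Type u} (F : Formula V) (σ : Finset (Lit V)) (n : ℕ)
    (b : Lit V → Finset ℕ) : Prop where
  /-- `σ` is an orbit of `Aut(F)` -/
  orbit : ∃ l : Lit V, (σ : Set (Lit V)) = MulAction.orbit (Aut F) l
  /-- `σ` and its negation form a disjoint direct factor -/
  factor : IsDisjointDirectFactor F ((σ : Set (Lit V)) ∪ neg '' (σ : Set (Lit V)))
  /-- `b` labels `σ` bijectively by the `2`-subsets of `[n]` -/
  bij : Set.BijOn b (σ : Set (Lit V)) (twoSubsets n : Set (Finset ℕ))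
  /-- every element of `Aut(F)` acts on `σ` as an element of `J_n` -/
  act : ∀ g ∈ Aut F, ∃ τ ∈ symGroup n, ∀ l ∈ σ, b (g l) = (b l).image τ
  /-- every element of `J_n` arises in this way -/
  full : ∀ τ ∈ symGroup n, ∃ g ∈ Aut F, ∀ l ∈ σ, b (g l) = (b l).image τ

/-- The permutation of `σ` induced by `τ` through the labeling `b`, i.e. by mapping the literal
labeled `{i, j}` to the one labeled `{τ i, τ j}`; literals outside `σ` are fixed. -/
def inducedPerm {V : Type u} (σ : Finset (Lit V)) (b : Lit V → Finset ℕ) (τ : Equiv.Perm ℕ)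
    (l : Lit V) : Lit V :=
  if h : l ∈ σ ∧ ∃ x ∈ σ, b x = (b l).image τ then h.2.choose else l

/-- The extension of a permutation of the literals to the negations of the literals it moves. -/
def expand {V : Type u} (φ : Lit V → Lit V) (l : Lit V) : Lit V :=
  if φ l ≠ l then φ l else if φ (neg l) ≠ neg l then neg (φ (neg l)) else l

/-! ### The detection algorithm -/

/-- The variables of the main loop: the lists `label[v]`, the adjacency sets `ad[v]` and the next
unused label `vnr`. -/
structure State (V : Type u) where
  label : Lit V → List ℕ
  ad : Lit V → Finset (Lit V)
  vnr : ℕ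

/-- A rule for the arbitrary choices in the algorithm; every choice may depend on the
current state. -/
structure Choices (V : Type u) where
  /-- the choice of `v` among the literals that are not completely labeled -/
  vertex : State V → ∀ A : Finset (Lit V), A.Nonempty → {x // x ∈ A}
  /-- the choice of `w` in `ad[v]` -/
  neighbor : State V → ∀ A : Finset (Lit V), A.Nonempty → {x // x ∈ A}
  /-- the smaller non-singleton fragment for `x`, in the event of a tie -/
  fragment : State V → Lit V → ∀ Q : Finset (Finset (Lit V)), Q.Nonempty → {S // S ∈ Q}

/-- The fragments of `σ` in the coloring `π` of the model graph. -/
def fragments {V : Type u} (F : Formula V) (σ : Finset (Lit V)) (π : Vertex F → ℕ) :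
    Finset (Finset (Lit V)) :=
  σ.image fun x => σ.filter fun y => π (Sum.inl y) = π (Sum.inl x)

/-- The non-singleton members of `Q` of smallest size. -/
def smallerFragments {V : Type u} (Q : Finset (Finset (Lit V))) : Finset (Finset (Lit V)) :=
  Q.filter fun S => 1 < S.card ∧ ∀ T ∈ Q, 1 < T.card → S.card ≤ T.card

/-- The coloring `π' = IR(G(F), ε)`. -/
def baseColoring {V : Type u} [Fintype V] (F : Formula V) : Vertex F → ℕ :=
  colorRefine (modelGraph F) (modelColoring F)

/-- Individualize `x`, check that `σ` has `3` fragments and add the elements of the smaller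
non-singleton fragment to `ad[x]`; the result is the new `ad`, or `none` if the check fails. -/
def explore {V : Type u} [Fintype V] (ch : Choices V) (F : Formula V) (σ : Finset (Lit V))
    (s : State V) (ad : Lit V → Finset (Lit V)) (x : Lit V) : Option (Lit V → Finset (Lit V)) :=
  let Q := fragments F σ (IR (modelGraph F) (baseColoring F) (Sum.inl x))
  if Q.card = 3 then
    if h : (smallerFragments Q).Nonempty then
      some (Function.update ad x (ad x ∪ (ch.fragment s x _ h).1))
    else none
  else none

/-- If the lists `label[x]`, `x ∈ E`, have no common entry, append `vnr` to each of them and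
increase `vnr`. -/
def mark {V : Type u} (s : State V) (E : Finset (Lit V)) : State V :=
  if ∃ k, ∀ x ∈ E, k ∈ s.label x then s
  else
    { s with
      label := fun x => if x ∈ E then s.label x ++ [s.vnr] else s.label x
      vnr := s.vnr + 1 }

/-- The literals different from `v` and `w` that form a singleton fragment of `σ` in
`π_{v,w} = IR((G, π_v), w)`. -/
def thirdSingletons {V : Type u} [Fintype V] (F : Formula V) (σ : Finset (Lit V))
    (v w : Lit V) : Finset (Lit V) :=
  let πv := IR (modelGraph F) (baseColoring F) (Sum.inl v)
  let πvw := IR (modelGraph F) πv (Sum.inl w)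
  σ.filter fun y => y ≠ v ∧ y ≠ w ∧ {y} ∈ fragments F σ πvw

/-- The body of the main loop, after `v` has been chosen; `none` means that the algorithm
returns `⊥`. -/
def iteration {V : Type u} [Fintype V] (ch : Choices V) (F : Formula V) (σ : Finset (Lit V))
    (s : State V) (v : Lit V) : Option (State V) := do
  let ad₁ ← explore ch F σ s s.ad v
  if hw : (ad₁ v).Nonempty then do
    let w : Lit V := (ch.neighbor s (ad₁ v) hw).1
    let ad₂ ← explore ch F σ s ad₁ w
    if hy : ∃ y, thirdSingletons F σ v w = {y} then do
      let y : Lit V := hy.choose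
      let ad ← explore ch F σ s ad₂ y
      let Ei := {v, y} ∪ (ad v ∩ ad y).erase w
      let Ej := {v, w} ∪ (ad v ∩ ad w).erase y
      let Ek := {w, y} ∪ (ad w ∩ ad y).erase v
      let s' := mark (mark (mark { s with ad := ad } Ei) Ej) Ek
      if s'.vnr = s.vnr then none else some s'
    else none
  else none

/-- The literals in `σ` with at most one label. -/
def unfinished {V : Type u} (σ : Finset (Lit V)) (s : State V) : Finset (Lit V) :=
  σ.filter fun v => (s.label v).length ≤ 1

/-- One test of the loop condition: either the loop is left (`Sum.inl`), with a final state
or with the result `⊥`, or it continues with a new state (`Sum.inr`). -/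
def loopStep {V : Type u} [Fintype V] (ch : Choices V) (F : Formula V) (σ : Finset (Lit V))
    (s : State V) : Option (State V) ⊕ State V :=
  if h : (unfinished σ s).Nonempty then
    match iteration ch F σ s (ch.vertex s _ h).1 with
    | none => Sum.inl none
    | some s' => Sum.inr s'
  else Sum.inl (some s)

/-- The while loop, as a partial function (it is undefined where the loop does not terminate). -/
def mainLoop {V : Type u} [Fintype V] (ch : Choices V) (F : Formula V) (σ : Finset (Lit V)) :
    State V →. Option (State V) :=
  PFun.fix fun s => Part.some (loopStep ch F σ s)

/-- The assignment of `2`-subsets to literals that is given by the lists `label[v]`. -/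
def labelSet {V : Type u} (label : Lit V → List ℕ) (l : Lit V) : Finset ℕ := (label l).toFinset

/-- The final verification: `label` induces a bijection between `σ` and the `2`-subsets of `[n]`,
and for every `i ∈ [n - 1]` the permutation of `σ` induced by the transposition `(i, i + 1)`,
expanded to the negations, is a symmetry of `F`. -/
def Verified {V : Type u} (F : Formula V) (σ : Finset (Lit V)) (n : ℕ)
    (label : Lit V → List ℕ) : Prop :=
  Set.BijOn (labelSet label) (σ : Set (Lit V)) (twoSubsets n : Set (Finset ℕ)) ∧
    ∀ i ∈ Finset.Icc 1 (n - 1),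
      IsSymmetry F (expand (inducedPerm σ (labelSet label) (Equiv.swap i (i + 1))))

/-- The detection algorithm for Johnson symmetry on input `F` and `σ`, with the choices `ch`.
`some label ∈ detectJohnson ch F σ` means that it terminates and returns `label`, and
`none ∈ detectJohnson ch F σ` that it terminates and returns `⊥`. -/
def detectJohnson {V : Type u} [Fintype V] (ch : Choices V) (F : Formula V)
    (σ : Finset (Lit V)) : Part (Option (Lit V → List ℕ)) :=
  if h : 28 ≤ σ.card ∧ ∃ n : ℕ, σ.card = n.choose 2 then
    (mainLoop ch F σ { label := fun _ => [], ad := fun _ => ∅, vnr := 1 }).map fun r =>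
      r.bind fun s => if Verified F σ (Nat.find h.2) s.label then some s.label else none
  else Part.some none

end

end JohnsonSym

open JohnsonSym

/-!
If the model graph is Tinhofer, the color classes after individualizing literals of a Johnson orbit
`σ` are the orbits of their pointwise stabilizer, and on `σ` these are the orbits of a stabilizer in
`Sym(n)` on `2`-subsets. Hence `π_v` splits `σ` according to the number of points shared with the
label of `v`, into fragments of sizes `1`, `2(n - 2)` and `(n - 2).choose 2`. For `n ≥ 8` the sizes
increase in this order (at `n = 7` the last two agree), so `ad[v]` consists of the labels meeting
that of `v`. If the labels of `v` and `w` are two sides of a triangle, every permutation stabilizing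
both also stabilizes the third side, their symmetric difference, and no further pair, which
identifies `y`. A label in `ad[v] ∩ ad[y]` contains the corner shared by `v` and `y` or is the side
`w`, so `E_i`, `E_j` and `E_k` are the stars of the three corners. Each iteration therefore names a
new point, and the loop ends with the points of `[n]` renamed by a permutation. The check succeeds
because symmetries of `F` restrict to the disjoint direct factor `σ ∪ ¬σ`.

Conversely, the permutations whose expansion is a symmetry of `F` are closed under products, and the
adjacent transpositions generate `Sym(n)`; so every returned labeling is correct.
-/

namespace JohnsonSym

universe u

/-! ### Color refinement -/

section Refinement

variable {U : Type u} [Fintype U] {G : SimpleGraph U} {π π₁ π₂ : U → ℕ}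

open scoped Classical in
theorem signature_eq_iff {x y : U} :
    signature G π x = signature G π y ↔
      π x = π y ∧ (Finset.univ.filter fun z => G.Adj x z).val.map π =
        (Finset.univ.filter fun z => G.Adj y z).val.map π := by
  rw [signature, signature, toLex_inj, Prod.mk.injEq]
  refine and_congr_right fun _ => ⟨fun h => ?_, fun h => by rw [h]⟩
  simpa only [Multiset.sort_eq] using congrArg (fun l : List ℕ => (l : Multiset ℕ)) h

theorem refineStep_lt_of_signature_lt {x y : U} (h : signature G π x < signature G π y) :
    refineStep G π x < refineStep G π y := by
  classical
  refine Finset.card_lt_card <| (Finset.ssubset_iff_of_subset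
    (Finset.monotone_filter_right _ fun _ _ ht => ht.trans h)).2 ⟨signature G π x, ?_, ?_⟩
  · exact Finset.mem_filter.2 ⟨Finset.mem_image_of_mem _ (Finset.mem_univ x), h⟩
  · exact fun hmem => lt_irrefl _ (Finset.mem_filter.1 hmem).2

theorem refineStep_eq_iff {x y : U} :
    refineStep G π x = refineStep G π y ↔ signature G π x = signature G π y := by
  refine ⟨fun h => ?_, fun h => by rw [refineStep, refineStep, h]⟩
  rcases lt_trichotomy (signature G π x) (signature G π y) with hlt | heq | hgt
  · exact absurd h (refineStep_lt_of_signature_lt hlt).ne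
  · exact heq
  · exact absurd h (refineStep_lt_of_signature_lt hgt).ne'

theorem factorsThrough_refineStep : π.FactorsThrough (refineStep G π) := fun _ _ h =>
  (signature_eq_iff.1 (refineStep_eq_iff.1 h)).1

theorem factorsThrough_colorRefine : π.FactorsThrough (colorRefine G π) := by
  unfold colorRefine
  induction Fintype.card U with
  | zero => exact fun _ _ h => h
  | succ k ih =>
    rw [Function.iterate_succ_apply']
    exact fun x y h => ih (factorsThrough_refineStep h)

theorem refineStep_mono (h : π₂.FactorsThrough π₁) :
    (refineStep G π₂).FactorsThrough (refineStep G π₁) := by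
  intro x y hxy
  rw [refineStep_eq_iff, signature_eq_iff] at hxy ⊢
  obtain ⟨f, rfl⟩ := (Function.factorsThrough_iff _).1 h
  refine ⟨h hxy.1, ?_⟩
  rw [← Multiset.map_map, ← Multiset.map_map, hxy.2]

theorem colorRefine_mono (h : π₂.FactorsThrough π₁) :
    (colorRefine G π₂).FactorsThrough (colorRefine G π₁) := by
  unfold colorRefine
  induction Fintype.card U with
  | zero => exact h
  | succ k ih =>
    rw [Function.iterate_succ_apply', Function.iterate_succ_apply']
    exact refineStep_mono ih

theorem IR_mono (h : π₂.FactorsThrough π₁) (v : U) :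
    (IR G π₂ v).FactorsThrough (IR G π₁ v) := by
  refine colorRefine_mono fun x y hxy => ?_
  unfold individualize at hxy ⊢
  split_ifs at hxy ⊢
  · rfl
  · rw [h (Nat.succ_injective hxy)]

theorem foldl_IR_mono (h : π₂.FactorsThrough π₁) (vs : List U) :
    (vs.foldl (IR G) π₂).FactorsThrough (vs.foldl (IR G) π₁) := by
  induction vs generalizing π₁ π₂ with
  | nil => exact h
  | cons v _ ih => exact ih (IR_mono h v)

theorem colorAut_le_colorAut_refineStep : colorAut G π ≤ colorAut G (refineStep G π) := by
  classical
  rintro g ⟨hadj, hcol⟩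
  refine ⟨hadj, fun x => refineStep_eq_iff.2 (signature_eq_iff.2 ⟨hcol x, ?_⟩)⟩
  have neighbors_image : (Finset.univ.filter fun z => G.Adj (g x) z) =
      (Finset.univ.filter fun z => G.Adj x z).map g.toEmbedding := by
    ext z
    simp only [Finset.mem_filter, Finset.mem_univ, true_and, Finset.mem_map_equiv]
    rw [← hadj x, Equiv.apply_symm_apply]
  rw [neighbors_image, Finset.map_val, Multiset.map_map]
  exact Multiset.map_congr rfl fun z _ => hcol z

theorem colorAut_colorRefine : colorAut G (colorRefine G π) = colorAut G π := by
  refine le_antisymm (fun g hg => ⟨hg.1, fun x => factorsThrough_colorRefine (hg.2 x)⟩) ?_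
  unfold colorRefine
  induction Fintype.card U with
  | zero => exact le_rfl
  | succ k ih =>
    rw [Function.iterate_succ_apply']
    exact ih.trans colorAut_le_colorAut_refineStep

theorem mem_colorAut_IR_iff {g : Equiv.Perm U} {v : U} :
    g ∈ colorAut G (IR G π v) ↔ g ∈ colorAut G π ∧ g v = v := by
  rw [IR, colorAut_colorRefine]
  constructor
  · rintro ⟨hadj, hcol⟩
    have fixes : g v = v := by
      by_contra hne
      simpa [individualize, hne] using hcol v
    refine ⟨⟨hadj, fun x => ?_⟩, fixes⟩
    rcases eq_or_ne x v with rfl | hx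
    · rw [fixes]
    · have hgx : g x ≠ v := fun h => hx (g.injective (h.trans fixes.symm))
      simpa [individualize, hx, hgx] using hcol x
  · rintro ⟨⟨hadj, hcol⟩, fixes⟩
    refine ⟨hadj, fun x => ?_⟩
    have apply_eq_iff : g x = v ↔ x = v := by rw [← g.injective.eq_iff (a := x), fixes]
    classical simp only [individualize, apply_eq_iff, hcol x]

theorem mem_colorAut_foldl_IR_iff {g : Equiv.Perm U} {vs : List U} :
    g ∈ colorAut G (vs.foldl (IR G) π) ↔ g ∈ colorAut G π ∧ ∀ v ∈ vs, g v = v := by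
  induction vs generalizing π with
  | nil => simp
  | cons v vs ih => rw [List.foldl_cons, ih, mem_colorAut_IR_iff, and_assoc, List.forall_mem_cons]

theorem IsTinhofer.foldl_IR_colorRefine_eq_iff (hT : IsTinhofer G π) {vs : List U} (hvs : vs ≠ [])
    {x y : U} :
    vs.foldl (IR G) (colorRefine G π) x = vs.foldl (IR G) (colorRefine G π) y ↔
      ∃ g ∈ colorAut G π, (∀ v ∈ vs, g v = v) ∧ g x = y := by
  constructor
  · intro hxy
    obtain rfl | ⟨ws, w, rfl⟩ := vs.eq_nil_or_concat
    · exact absurd rfl hvs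
    -- The Tinhofer property is about starting from `π`; the start `colorRefine G π` is finer.
    have same_color : IR G (ws.foldl (IR G) π) w x = IR G (ws.foldl (IR G) π) w y := by
      simpa using foldl_IR_mono factorsThrough_colorRefine _ hxy
    obtain ⟨g, hg, hw, hgx⟩ := (hT ws w x y).2 same_color
    rw [mem_colorAut_foldl_IR_iff] at hg
    exact ⟨g, hg.1, by simpa [or_imp, forall_and] using ⟨hg.2, hw⟩, hgx⟩
  · rintro ⟨g, hg, hvs, rfl⟩
    exact ((mem_colorAut_foldl_IR_iff.2 ⟨colorAut_colorRefine.ge hg, hvs⟩).2 x).symm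

end Refinement

/-! ### Automorphisms of the model graph -/

section ModelGraph

variable {V : Type u} {F : Formula V}

theorem neg_neg (l : Lit V) : neg (neg l) = l := by simp [neg]

theorem neg_ne (l : Lit V) : neg l ≠ l := by simp [neg, Prod.ext_iff]

theorem neg_injective : Function.Injective (neg : Lit V → Lit V) :=
  Function.LeftInverse.injective neg_neg

open scoped Classical in
theorem isSymmetry_of_image_mem {f : Lit V → Lit V} (hf : Function.Bijective f)
    (hneg : ∀ l, f (neg l) = neg (f l)) (hF : ∀ C ∈ F, C.image f ∈ F) : IsSymmetry F f :=
  ⟨hf, hneg, Finset.eq_of_subset_of_card_le (Finset.image_subset_iff.2 hF)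
    (Finset.card_image_of_injective _ (Finset.image_injective hf.injective)).ge⟩

open scoped Classical in
theorem image_mem_of_mem_Aut {h : Equiv.Perm (Lit V)} (hh : h ∈ Aut F) {C : Finset (Lit V)}
    (hC : C ∈ F) : C.image h ∈ F := by
  simpa only [hh.2.2] using Finset.mem_image_of_mem (fun C : Finset (Lit V) => C.image h) hC

theorem exists_mem_colorAut_of_mem_Aut {h : Equiv.Perm (Lit V)} (hh : h ∈ Aut F) :
    ∃ g ∈ colorAut (modelGraph F) (modelColoring F), ∀ l, g (.inl l) = .inl (h l) := by
  classical
  let c : {C // C ∈ F} → {C // C ∈ F} := fun C => ⟨C.1.image h, image_mem_of_mem_Aut hh C.2⟩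
  have c_injective : Function.Injective c := fun C D hCD =>
    Subtype.ext (Finset.image_injective h.injective (congrArg Subtype.val hCD))
  refine ⟨Equiv.sumCongr h (.ofBijective c (Finite.injective_iff_bijective.1 c_injective)),
    ⟨?_, ?_⟩, fun _ => rfl⟩
  · rintro (a | C) (b | D)
    · change h b = neg (h a) ↔ b = neg a
      rw [← hh.2.1, h.injective.eq_iff]
    · exact h.injective.mem_finset_image
    · exact h.injective.mem_finset_image
    · exact Iff.rfl
  · rintro (a | C) <;> rfl

theorem exists_mem_Aut_of_mem_colorAut [Finite V] {g : Equiv.Perm (Vertex F)}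
    (hg : g ∈ colorAut (modelGraph F) (modelColoring F)) :
    ∃ h ∈ Aut F, ∀ l, g (.inl l) = .inl (h l) := by
  classical
  obtain ⟨hadj, hcol⟩ := hg
  have mapsTo_inl : Set.MapsTo g (Set.range Sum.inl) (Set.range Sum.inl) := by
    rintro _ ⟨l, rfl⟩
    cases hgl : g (.inl l) with
    | inl l' => exact ⟨l', rfl⟩
    | inr C => simpa [hgl, modelColoring] using hcol (.inl l)
  obtain ⟨⟨h, c⟩, rfl⟩ := Equiv.Perm.mem_sumCongrHom_range_of_perm_mapsTo_inl mapsTo_inl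
  refine ⟨h, isSymmetry_of_image_mem h.bijective (fun l => ?_) (fun C hC => ?_), fun _ => rfl⟩
  · exact (hadj (.inl l) (.inl (neg l))).2 rfl
  · have image_eq : C.image h = (c ⟨C, hC⟩).1 := by
      ext a
      obtain ⟨a, rfl⟩ := h.surjective a
      rw [h.injective.mem_finset_image]
      exact (hadj (.inl a) (.inr ⟨C, hC⟩)).symm
    exact image_eq ▸ (c ⟨C, hC⟩).2

variable [Fintype V]

/-- The coloring of the model graph after individualizing the literals `vs` one after another,
refining each time: `irColoring F [v]` and `irColoring F [v, w]` are the colorings `π_v` and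
`IR((G, π_v), w)` of the algorithm. -/
noncomputable def irColoring (F : Formula V) (vs : List (Lit V)) : Vertex F → ℕ :=
  (vs.map Sum.inl).foldl (IR (modelGraph F)) (baseColoring F)

theorem IsTinhofer.irColoring_eq_iff (hT : IsTinhofer (modelGraph F) (modelColoring F))
    {vs : List (Lit V)} (hvs : vs ≠ []) {x y : Lit V} :
    irColoring F vs (.inl x) = irColoring F vs (.inl y) ↔
      ∃ h ∈ Aut F, (∀ v ∈ vs, h v = v) ∧ h x = y := by
  refine (hT.foldl_IR_colorRefine_eq_iff (mt List.map_eq_nil_iff.1 hvs)).trans ⟨?_, ?_⟩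
  · rintro ⟨g, hg, hfix, hgx⟩
    obtain ⟨h, hh, hgh⟩ := exists_mem_Aut_of_mem_colorAut hg
    exact ⟨h, hh, by simpa only [List.forall_mem_map, hgh, Sum.inl.injEq] using hfix,
      by simpa only [hgh, Sum.inl.injEq] using hgx⟩
  · rintro ⟨h, hh, hfix, hhx⟩
    obtain ⟨g, hg, hgh⟩ := exists_mem_colorAut_of_mem_Aut hh
    exact ⟨g, hg, by simpa only [List.forall_mem_map, hgh, Sum.inl.injEq] using hfix,
      by rw [hgh, hhx]⟩

end ModelGraph

/-! ### The symmetric group on `[n]` -/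

section SymGroup

variable {n : ℕ} {τ : Equiv.Perm ℕ}

theorem mem_symGroup : τ ∈ symGroup n ↔ ∀ k, k ∉ Finset.Icc 1 n → τ k = k := Iff.rfl

theorem apply_mem_Icc_iff (hτ : τ ∈ symGroup n) {k : ℕ} :
    τ k ∈ Finset.Icc 1 n ↔ k ∈ Finset.Icc 1 n := by
  refine ⟨fun h => ?_, fun h => ?_⟩ <;> by_contra hk
  · exact hk (by rwa [mem_symGroup.1 hτ k hk] at h)
  · exact hk (by rwa [τ.injective (mem_symGroup.1 hτ _ hk)])

theorem ofSubtype_mem_symGroup (ρ : Equiv.Perm {k // k ∈ Finset.Icc 1 n}) :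
    Equiv.Perm.ofSubtype ρ ∈ symGroup n := fun _ => Equiv.Perm.ofSubtype_apply_of_not_mem ρ

theorem exists_ofSubtype_eq (hτ : τ ∈ symGroup n) :
    ∃ ρ : Equiv.Perm {k // k ∈ Finset.Icc 1 n}, Equiv.Perm.ofSubtype ρ = τ :=
  ⟨τ.subtypePerm fun _ => apply_mem_Icc_iff hτ,
    Equiv.Perm.ofSubtype_subtypePerm _ fun k hk => not_imp_comm.1 (hτ k) hk⟩

theorem swap_mem_symGroup {i j : ℕ} (hi : i ∈ Finset.Icc 1 n) (hj : j ∈ Finset.Icc 1 n) :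
    Equiv.swap i j ∈ symGroup n := fun _ hk =>
  Equiv.swap_apply_of_ne_of_ne (fun h => hk (h ▸ hi)) (fun h => hk (h ▸ hj))

theorem swap_succ_mem_symGroup {i : ℕ} (hi : i ∈ Finset.Icc 1 (n - 1)) :
    Equiv.swap i (i + 1) ∈ symGroup n := by
  rw [Finset.mem_Icc] at hi
  exact swap_mem_symGroup (Finset.mem_Icc.2 ⟨hi.1, by omega⟩)
    (Finset.mem_Icc.2 ⟨by omega, by omega⟩)

theorem swap_mem_of_swap_succ_mem {S : Submonoid (Equiv.Perm ℕ)}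
    (hS : ∀ i ∈ Finset.Icc 1 (n - 1), Equiv.swap i (i + 1) ∈ S) {a c : ℕ} (ha : 1 ≤ a)
    (hac : a < c) (hc : c ≤ n) : Equiv.swap a c ∈ S := by
  induction c, hac using Nat.le_induction with
  | base => exact hS a (Finset.mem_Icc.2 ⟨ha, by omega⟩)
  | succ c hac ih =>
    have conj : Equiv.swap a c * Equiv.swap c (c + 1) * Equiv.swap a c = Equiv.swap a (c + 1) := by
      rw [Equiv.swap_comm a c, Equiv.swap_comm c (c + 1)]
      exact Equiv.swap_mul_swap_mul_swap (by omega) (by omega)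
    have left_mem := ih (by omega)
    have right_mem := hS c (Finset.mem_Icc.2 ⟨by omega, by omega⟩)
    exact conj ▸ S.mul_mem (S.mul_mem left_mem right_mem) left_mem

theorem mem_of_swap_succ_mem {S : Submonoid (Equiv.Perm ℕ)}
    (hS : ∀ i ∈ Finset.Icc 1 (n - 1), Equiv.swap i (i + 1) ∈ S) (hτ : τ ∈ symGroup n) :
    τ ∈ S := by
  obtain ⟨ρ, rfl⟩ := exists_ofSubtype_eq hτ
  induction ρ using Equiv.Perm.swap_induction_on with
  | one => simpa only [map_one] using S.one_mem
  | swap_mul ρ i j hij ih =>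
    rw [map_mul, Equiv.Perm.ofSubtype_swap_eq]
    refine S.mul_mem ?_ (ih (ofSubtype_mem_symGroup ρ))
    have hi := Finset.mem_Icc.1 i.2
    have hj := Finset.mem_Icc.1 j.2
    rcases lt_or_gt_of_ne (Subtype.coe_ne_coe.2 hij) with hlt | hgt
    · exact swap_mem_of_swap_succ_mem hS hi.1 hlt hj.2
    · exact Equiv.swap_comm (j : ℕ) i ▸ swap_mem_of_swap_succ_mem hS hj.1 hgt hi.2

theorem exists_mem_symGroup_eqOn {f : ℕ → ℕ} (hmaps : ∀ k ∈ Finset.Icc 1 n, f k ∈ Finset.Icc 1 n)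
    (hinj : Set.InjOn f (Finset.Icc 1 n : Finset ℕ)) :
    ∃ τ ∈ symGroup n, ∀ k ∈ Finset.Icc 1 n, τ k = f k := by
  let e : {k // k ∈ Finset.Icc 1 n} → {k // k ∈ Finset.Icc 1 n} := fun k => ⟨f k, hmaps k k.2⟩
  have e_injective : Function.Injective e := fun i j hij =>
    Subtype.ext (hinj i.2 j.2 (congrArg Subtype.val hij))
  refine ⟨_, ofSubtype_mem_symGroup (.ofBijective e (Finite.injective_iff_bijective.1 e_injective)),
    fun k hk => ?_⟩
  rw [Equiv.Perm.ofSubtype_apply_of_mem _ hk, Equiv.ofBijective_apply]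

theorem exists_mem_symGroup_comp_eq {ι : Type*} [DecidableEq ι] {f g : ℕ → ι}
    (hfg : ∀ c, ((Finset.Icc 1 n).filter (f · = c)).card =
      ((Finset.Icc 1 n).filter (g · = c)).card) :
    ∃ τ ∈ symGroup n, ∀ k ∈ Finset.Icc 1 n, g (τ k) = f k := by
  have fiberEquiv (h : ℕ → ι) (c : ι) :
      {k : {k // k ∈ Finset.Icc 1 n} // h k = c} ≃ {k // k ∈ (Finset.Icc 1 n).filter (h · = c)} :=
    (Equiv.subtypeSubtypeEquivSubtypeInter (· ∈ Finset.Icc 1 n) (h · = c)).trans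
      (Equiv.subtypeEquivRight fun _ => by rw [Finset.mem_filter])
  let e (c : ι) := ((fiberEquiv f c).trans (Finset.equivOfCardEq (hfg c))).trans
    (fiberEquiv g c).symm
  refine ⟨_, ofSubtype_mem_symGroup (Equiv.ofFiberEquiv e), fun k hk => ?_⟩
  rw [Equiv.Perm.ofSubtype_apply_of_mem _ hk]
  exact Equiv.ofFiberEquiv_map e ⟨k, hk⟩

theorem exists_mem_symGroup_image_ne {S B : Finset ℕ} (hB : B ⊆ Finset.Icc 1 n)
    (hBS : ¬ B ⊆ S) (hcard : (S ∪ B).card < n) :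
    ∃ τ ∈ symGroup n, (∀ i ∈ S, τ i = i) ∧ B.image τ ≠ B := by
  obtain ⟨p, hpB, hpS⟩ := Finset.not_subset.1 hBS
  obtain ⟨q, hq, hqn⟩ : ∃ q ∈ Finset.Icc 1 n, q ∉ S ∪ B :=
    Finset.exists_mem_notMem_of_card_lt_card (by simpa using hcard)
  rw [Finset.mem_union, not_or] at hqn
  refine ⟨Equiv.swap p q, swap_mem_symGroup (hB hpB) hq, fun i hi =>
    Equiv.swap_apply_of_ne_of_ne (fun h => hpS (h ▸ hi)) (fun h => hqn.1 (h ▸ hi)), fun h => ?_⟩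
  exact hqn.2 (h ▸ Finset.mem_image.2 ⟨p, hpB, Equiv.swap_apply_left p q⟩)

theorem card_filter_mem_iff_and_mem_iff {I A B : Finset ℕ} (hA : A ⊆ I) (hB : B ⊆ I)
    (x y : Bool) :
    (I.filter fun k => (decide (k ∈ A), decide (k ∈ B)) = (x, y)).card =
      match x, y with
      | true, true => (A ∩ B).card
      | true, false => A.card - (A ∩ B).card
      | false, true => B.card - (A ∩ B).card
      | false, false => I.card - (A.card + B.card - (A ∩ B).card) := by
  cases x <;> cases y <;> simp only [Prod.mk.injEq, decide_eq_true_eq, decide_eq_false_iff_not]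
  · rw [← Finset.card_union, ← Finset.card_sdiff_of_subset (Finset.union_subset hA hB)]
    congr 1
    grind
  · rw [← Finset.card_sdiff]
    congr 1
    grind
  · rw [Finset.inter_comm, ← Finset.card_sdiff]
    congr 1
    grind
  · congr 1
    grind

theorem exists_image_eq_iff_card_inter_eq {A B C : Finset ℕ} (hA : A ⊆ Finset.Icc 1 n)
    (hB : B ⊆ Finset.Icc 1 n) (hC : C ⊆ Finset.Icc 1 n) (hBC : B.card = C.card) :
    (∃ τ ∈ symGroup n, A.image τ = A ∧ B.image τ = C) ↔ (A ∩ B).card = (A ∩ C).card := by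
  constructor
  · rintro ⟨τ, -, hτA, rfl⟩
    conv_rhs => rw [← hτA]
    rw [← Finset.image_inter _ _ τ.injective, Finset.card_image_of_injective _ τ.injective]
  · intro hcard
    obtain ⟨τ, hτ, hmem⟩ := exists_mem_symGroup_comp_eq (n := n)
      (f := fun k => (decide (k ∈ A), decide (k ∈ B)))
      (g := fun k => (decide (k ∈ A), decide (k ∈ C))) (fun c => by
        rw [card_filter_mem_iff_and_mem_iff hA hB, card_filter_mem_iff_and_mem_iff hA hC, hBC,
          hcard])
    simp only [Prod.mk.injEq, decide_eq_decide] at hmem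
    have image_eq {S T : Finset ℕ} (hST : S.card = T.card) (h : ∀ k ∈ S, τ k ∈ T) :
        S.image τ = T :=
      Finset.eq_of_subset_of_card_le (Finset.image_subset_iff.2 h)
        (by rw [Finset.card_image_of_injective _ τ.injective, hST])
    exact ⟨τ, hτ, image_eq rfl fun k hk => (hmem k (hA hk)).1.2 hk,
      image_eq hBC fun k hk => (hmem k (hB hk)).2.2 hk⟩

end SymGroup

/-! ### Two-element subsets of `[n]` -/

section TwoSubsets

variable {n : ℕ} {A B T : Finset ℕ}

theorem mem_twoSubsets : T ∈ twoSubsets n ↔ T ⊆ Finset.Icc 1 n ∧ T.card = 2 :=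
  Finset.mem_powersetCard

theorem image_mem_twoSubsets {τ : Equiv.Perm ℕ} (hτ : τ ∈ symGroup n) (hT : T ∈ twoSubsets n) :
    T.image τ ∈ twoSubsets n := by
  rw [mem_twoSubsets] at hT ⊢
  refine ⟨Finset.image_subset_iff.2 fun k hk => (apply_mem_Icc_iff hτ).2 (hT.1 hk), ?_⟩
  rw [Finset.card_image_of_injective _ τ.injective, hT.2]

theorem bijOn_image_twoSubsets {τ : Equiv.Perm ℕ} (hτ : τ ∈ symGroup n) :
    Set.BijOn (Finset.image τ) (twoSubsets n : Set (Finset ℕ)) (twoSubsets n) :=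
  have mapsTo : Set.MapsTo (Finset.image τ) (twoSubsets n : Set (Finset ℕ)) (twoSubsets n) :=
    fun _ => image_mem_twoSubsets hτ
  have injOn := (Finset.image_injective τ.injective).injOn
  ⟨mapsTo, injOn, Finset.surjOn_of_injOn_of_card_le _ mapsTo injOn le_rfl⟩

theorem eq_pair_of_mem_of_mem {p q : ℕ} (hT : T.card = 2) (hpq : p ≠ q) (hp : p ∈ T)
    (hq : q ∈ T) : T = {p, q} :=
  (Finset.eq_of_subset_of_card_le (Finset.insert_subset hp (Finset.singleton_subset_iff.2 hq))
    (by rw [hT, Finset.card_pair hpq])).symm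

theorem exists_eq_pair_of_mem {p : ℕ} (hT : T.card = 2) (hp : p ∈ T) : ∃ q ≠ p, T = {p, q} := by
  obtain ⟨q, hq, hqp⟩ := Finset.exists_mem_ne (by omega : 1 < T.card) p
  exact ⟨q, hqp, eq_pair_of_mem_of_mem hT hqp.symm hp hq⟩

theorem exists_eq_pair_eq_pair_of_card_inter_eq_one (hA : A.card = 2) (hB : B.card = 2)
    (hAB : (A ∩ B).card = 1) :
    ∃ p q r, p ≠ q ∧ p ≠ r ∧ q ≠ r ∧ A = {p, q} ∧ B = {p, r} := by
  obtain ⟨p, hp⟩ := Finset.card_pos.1 (by omega : 0 < (A ∩ B).card)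
  rw [Finset.mem_inter] at hp
  obtain ⟨q, hqp, rfl⟩ := exists_eq_pair_of_mem hA hp.1
  obtain ⟨r, hrp, rfl⟩ := exists_eq_pair_of_mem hB hp.2
  refine ⟨p, q, r, hqp.symm, hrp.symm, ?_, rfl, rfl⟩
  rintro rfl
  rw [Finset.inter_self] at hAB
  omega

theorem card_pair_inter {p q : ℕ} (hpq : p ≠ q) (T : Finset ℕ) :
    (({p, q} : Finset ℕ) ∩ T).card = (if p ∈ T then 1 else 0) + if q ∈ T then 1 else 0 := by
  by_cases hp : p ∈ T <;> by_cases hq : q ∈ T <;> simp [hp, hq, hpq]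

open scoped symmDiff

theorem card_symmDiff_add_two_mul_card_inter (A B : Finset ℕ) :
    (A ∆ B).card + 2 * (A ∩ B).card = A.card + B.card := by
  have hdisj : Disjoint (A \ B) (B \ A) := disjoint_sdiff_sdiff
  rw [symmDiff_def, Finset.sup_eq_union, Finset.card_union_of_disjoint hdisj]
  have hA := Finset.card_sdiff_add_card_inter A B
  have hB := Finset.card_sdiff_add_card_inter B A
  rw [Finset.inter_comm] at hB
  omega

theorem symmDiff_mem_twoSubsets (hA : A ∈ twoSubsets n) (hB : B ∈ twoSubsets n)
    (hAB : (A ∩ B).card = 1) : A ∆ B ∈ twoSubsets n := by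
  rw [mem_twoSubsets] at hA hB ⊢
  have hcard := card_symmDiff_add_two_mul_card_inter A B
  refine ⟨fun k hk => ?_, by omega⟩
  rcases Finset.mem_symmDiff.1 hk with h | h
  exacts [hA.1 h.1, hB.1 h.1]

theorem eq_symmDiff_of_subset_union (hA : A.card = 2) (hB : B.card = 2) (hT : T.card = 2)
    (hAB : (A ∩ B).card = 1) (hTA : T ≠ A) (hTB : T ≠ B) (hsub : T ⊆ A ∪ B) : T = A ∆ B := by
  have exists_notMem : ∀ {S : Finset ℕ}, S.card = 2 → T ≠ S → ∃ t ∈ T, t ∉ S := fun hS hTS =>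
    Finset.not_subset.1 fun h => hTS (Finset.eq_of_subset_of_card_le h (hS.trans hT.symm).le)
  obtain ⟨t, htT, htA⟩ := exists_notMem hA hTA
  obtain ⟨s, hsT, hsB⟩ := exists_notMem hB hTB
  have htB : t ∈ B := (Finset.mem_union.1 (hsub htT)).resolve_left htA
  have hsA : s ∈ A := (Finset.mem_union.1 (hsub hsT)).resolve_right hsB
  have hts : t ≠ s := ne_of_mem_of_not_mem htB hsB
  have hcard := card_symmDiff_add_two_mul_card_inter A B
  rw [eq_pair_of_mem_of_mem hT hts htT hsT]
  refine (eq_pair_of_mem_of_mem (by omega) hts ?_ ?_).symm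
  exacts [Finset.mem_symmDiff.2 (.inr ⟨htB, htA⟩), Finset.mem_symmDiff.2 (.inl ⟨hsA, hsB⟩)]

theorem forall_image_eq_iff_eq_symmDiff (hn : 6 ≤ n) (hA : A.card = 2) (hB : B.card = 2)
    (hT : T ∈ twoSubsets n) (hAB : (A ∩ B).card = 1) (hTA : T ≠ A) (hTB : T ≠ B) :
    (∀ τ ∈ symGroup n, A.image τ = A → B.image τ = B → T.image τ = T) ↔ T = A ∆ B := by
  rw [mem_twoSubsets] at hT
  constructor
  · intro hfix
    refine eq_symmDiff_of_subset_union hA hB hT.2 hAB hTA hTB (by_contra fun hsub => ?_)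
    have card_lt : ((A ∪ B) ∪ T).card < n := by
      have h₁ := Finset.card_union_add_card_inter A B
      have h₂ := Finset.card_union_le (A ∪ B) T
      omega
    obtain ⟨τ, hτ, hτAB, hne⟩ := exists_mem_symGroup_image_ne hT.1 hsub card_lt
    have image_eq : ∀ S ⊆ A ∪ B, S.image τ = S := fun S hS =>
      (Finset.image_congr fun i hi => hτAB i (hS hi)).trans Finset.image_id
    exact hne (hfix τ hτ (image_eq A Finset.subset_union_left)
      (image_eq B Finset.subset_union_right))
  · rintro rfl τ - hτA hτB
    rw [Finset.image_symmDiff _ _ τ.injective, hτA, hτB]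

theorem succ_choose_two (m : ℕ) : (m + 1).choose 2 = m + m.choose 2 := by
  rw [Nat.choose_succ_succ' m 1, Nat.choose_one_right]

theorem two_mul_lt_choose_two {m : ℕ} (hm : 6 ≤ m) : 2 * m < m.choose 2 := by
  induction m, hm using Nat.le_induction with
  | base => decide
  | succ m _ ih =>
    rw [succ_choose_two]
    omega

theorem strictMonoOn_choose_two : StrictMonoOn (fun m => m.choose 2) (Set.Ici 1) := by
  intro m hm k _ hmk
  obtain ⟨k, rfl⟩ := Nat.exists_eq_add_of_lt hmk
  have choose_le := Nat.choose_le_choose 2 (Nat.le_add_right m k)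
  have one_le := Set.mem_Ici.1 hm
  dsimp only
  rw [succ_choose_two]
  omega

theorem eq_of_choose_two_eq {m : ℕ} (hn : 2 ≤ n) (h : m.choose 2 = n.choose 2) : m = n := by
  have hm : 2 ≤ m := Nat.choose_ne_zero_iff.1 (h ▸ Nat.choose_ne_zero_iff.2 hn)
  exact strictMonoOn_choose_two.injOn (Set.mem_Ici.2 (by omega)) (Set.mem_Ici.2 (by omega)) h

end TwoSubsets

/-! ### Labelings by pairs -/

section PairLabeling

variable {α : Type*} {σ : Finset α} {b : α → Finset ℕ} {n : ℕ}

/-- `b` labels `σ` bijectively by the `2`-subsets of `[n]`. -/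
def IsPairLabeling (σ : Finset α) (b : α → Finset ℕ) (n : ℕ) : Prop :=
  Set.BijOn b (σ : Set α) (twoSubsets n : Set (Finset ℕ))

/-- The elements of `σ` whose label has exactly `c` points in common with the label of `v`. For
`c = 2, 1, 0` these are the three fragments of a Johnson orbit `σ` in `π_v`. -/
def meeting (σ : Finset α) (b : α → Finset ℕ) (v : α) (c : ℕ) : Finset α :=
  σ.filter fun x => (b v ∩ b x).card = c

/-- The elements of `σ` whose label contains the point `p`; the sets `E_i`, `E_j`, `E_k` of the
algorithm are of this form. -/
def star (σ : Finset α) (b : α → Finset ℕ) (p : ℕ) : Finset α := σ.filter fun x => p ∈ b x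

theorem mem_meeting {v x : α} {c : ℕ} : x ∈ meeting σ b v c ↔ x ∈ σ ∧ (b v ∩ b x).card = c :=
  Finset.mem_filter

theorem mem_star {x : α} {p : ℕ} : x ∈ star σ b p ↔ x ∈ σ ∧ p ∈ b x := Finset.mem_filter

namespace IsPairLabeling

theorem comp_image (hb : IsPairLabeling σ b n) {τ : Equiv.Perm ℕ} (hτ : τ ∈ symGroup n) :
    IsPairLabeling σ (fun l => (b l).image τ) n := (bijOn_image_twoSubsets hτ).comp hb

theorem label_subset (hb : IsPairLabeling σ b n) {x : α} (hx : x ∈ σ) : b x ⊆ Finset.Icc 1 n :=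
  (mem_twoSubsets.1 (hb.mapsTo hx)).1

theorem card_label (hb : IsPairLabeling σ b n) {x : α} (hx : x ∈ σ) : (b x).card = 2 :=
  (mem_twoSubsets.1 (hb.mapsTo hx)).2

theorem exists_label_eq (hb : IsPairLabeling σ b n) {p q : ℕ} (hpq : p ≠ q)
    (hp : p ∈ Finset.Icc 1 n) (hq : q ∈ Finset.Icc 1 n) : ∃ x ∈ σ, b x = {p, q} :=
  hb.surjOn (mem_twoSubsets.2
    ⟨Finset.insert_subset hp (Finset.singleton_subset_iff.2 hq), Finset.card_pair hpq⟩)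

theorem exists_inter_eq_singleton (hb : IsPairLabeling σ b n) (hn : 3 ≤ n) {p : ℕ}
    (hp : p ∈ Finset.Icc 1 n) : ∃ x ∈ star σ b p, ∃ y ∈ star σ b p, b x ∩ b y = {p} := by
  have one_lt_card : 1 < ((Finset.Icc 1 n).erase p).card := by
    rw [Finset.card_erase_of_mem hp, Nat.card_Icc]
    omega
  obtain ⟨q, hq, r, hr, hqr⟩ := Finset.one_lt_card.1 one_lt_card
  rw [Finset.mem_erase] at hq hr
  obtain ⟨x, hx, hbx⟩ := hb.exists_label_eq hq.1.symm hp hq.2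
  obtain ⟨y, hy, hby⟩ := hb.exists_label_eq hr.1.symm hp hr.2
  refine ⟨x, mem_star.2 ⟨hx, by simp [hbx]⟩, y, mem_star.2 ⟨hy, by simp [hby]⟩, ?_⟩
  rw [hbx, hby, ← Finset.insert_inter_distrib, Finset.singleton_inter_of_notMem (by simpa),
    insert_empty_eq]

theorem card_filter (hb : IsPairLabeling σ b n) (P : Finset ℕ → Prop) [DecidablePred P] :
    (σ.filter fun x => P (b x)).card = ((twoSubsets n).filter P).card := by
  refine Finset.card_bij (fun x _ => b x) (fun x hx => ?_) (fun x hx y hy hxy => ?_)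
    fun T hT => ?_
  · rw [Finset.mem_filter] at hx ⊢
    exact ⟨hb.mapsTo hx.1, hx.2⟩
  · exact hb.injOn (Finset.mem_of_mem_filter x hx) (Finset.mem_of_mem_filter y hy) hxy
  · rw [Finset.mem_filter] at hT
    obtain ⟨x, hx, rfl⟩ := hb.surjOn hT.1
    exact ⟨x, Finset.mem_filter.2 ⟨hx, hT.2⟩, rfl⟩

theorem card_eq (hb : IsPairLabeling σ b n) : σ.card = n.choose 2 := by
  rw [Finset.card_nbij b hb.mapsTo hb.injOn hb.surjOn, twoSubsets, Finset.card_powersetCard,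
    Nat.card_Icc, Nat.add_sub_cancel]

theorem card_inter_lt_three (hb : IsPairLabeling σ b n) {v : α} (hv : v ∈ σ) (x : α) :
    (b v ∩ b x).card < 3 :=
  ((Finset.card_le_card Finset.inter_subset_left).trans_eq (hb.card_label hv)).trans_lt
    (by norm_num)

theorem meeting_two (hb : IsPairLabeling σ b n) {v : α} (hv : v ∈ σ) :
    meeting σ b v 2 = {v} := by
  ext x
  rw [mem_meeting, Finset.mem_singleton]
  constructor
  · rintro ⟨hx, hvx⟩
    have eq_left : b v ∩ b x = b v := Finset.eq_of_subset_of_card_le Finset.inter_subset_left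
      (by rw [hvx, hb.card_label hv])
    have eq_right : b v ∩ b x = b x := Finset.eq_of_subset_of_card_le Finset.inter_subset_right
      (by rw [hvx, hb.card_label hx])
    exact hb.injOn hx hv (eq_right.symm.trans eq_left)
  · rintro rfl
    exact ⟨hv, by rw [Finset.inter_self, hb.card_label hv]⟩

theorem card_meeting_zero (hb : IsPairLabeling σ b n) {v : α} (hv : v ∈ σ) :
    (meeting σ b v 0).card = (n - 2).choose 2 := by
  have disjoint_pairs : ((twoSubsets n).filter fun T => (b v ∩ T).card = 0) =
      (Finset.Icc 1 n \ b v).powersetCard 2 := by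
    ext T
    rw [Finset.mem_filter, mem_twoSubsets, Finset.mem_powersetCard, Finset.subset_sdiff,
      Finset.card_eq_zero, ← Finset.disjoint_iff_inter_eq_empty, disjoint_comm, and_right_comm]
  rw [meeting, hb.card_filter fun T => (b v ∩ T).card = 0, disjoint_pairs, Finset.card_powersetCard,
    Finset.card_sdiff_of_subset (hb.label_subset hv), Nat.card_Icc, hb.card_label hv,
    Nat.add_sub_cancel]

theorem card_meeting_one (hb : IsPairLabeling σ b n) (hn : 2 ≤ n) {v : α} (hv : v ∈ σ) :
    (meeting σ b v 1).card = 2 * (n - 2) := by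
  have card_sum : σ.card = ∑ c ∈ Finset.range 3, (meeting σ b v c).card :=
    Finset.card_eq_sum_card_fiberwise fun x _ =>
      Finset.mem_coe.2 (Finset.mem_range.2 (hb.card_inter_lt_three hv x))
  rw [Finset.sum_range_succ, Finset.sum_range_succ, Finset.sum_range_succ, Finset.sum_range_zero,
    hb.card_meeting_zero hv, hb.meeting_two hv, Finset.card_singleton, hb.card_eq] at card_sum
  obtain ⟨m, rfl⟩ := Nat.exists_eq_add_of_le' hn
  rw [succ_choose_two, succ_choose_two, Nat.add_sub_cancel] at card_sum
  omega

theorem card_meeting_one_lt (hb : IsPairLabeling σ b n) (hn : 8 ≤ n) {v : α} (hv : v ∈ σ) :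
    (meeting σ b v 1).card < (meeting σ b v 0).card := by
  rw [hb.card_meeting_one (by omega) hv, hb.card_meeting_zero hv]
  exact two_mul_lt_choose_two (by omega)

theorem pair_union_eq_star [DecidableEq α] (hb : IsPairLabeling σ b n) {v w y : α} (hv : v ∈ σ)
    (hw : w ∈ σ) (hy : y ∈ σ) {p q r : ℕ} (hpq : p ≠ q) (hpr : p ≠ r) (hqr : q ≠ r)
    (hbv : b v = {p, q}) (hby : b y = {p, r}) (hbw : b w = {q, r}) :
    {v, y} ∪ (meeting σ b v 1 ∩ meeting σ b y 1).erase w = star σ b p := by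
  ext x
  simp only [Finset.mem_union, Finset.mem_insert, Finset.mem_singleton, Finset.mem_erase,
    Finset.mem_inter, mem_meeting, mem_star, hbv, hby, card_pair_inter hpq, card_pair_inter hpr]
  constructor
  · rintro ((rfl | rfl) | ⟨hxw, ⟨hx, meets_v⟩, -, meets_y⟩)
    · exact ⟨hv, by simp [hbv]⟩
    · exact ⟨hy, by simp [hby]⟩
    · refine ⟨hx, by_contra fun hp => hxw ?_⟩
      rw [if_neg hp, zero_add, ite_eq_left_iff, not_imp_comm] at meets_v meets_y
      refine hb.injOn hx hw ?_
      rw [hbw]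
      exact eq_pair_of_mem_of_mem (hb.card_label hx) hqr (meets_v zero_ne_one)
        (meets_y zero_ne_one)
  · rintro ⟨hx, hp⟩
    refine or_iff_not_imp_left.2 fun hxvy => ?_
    rw [not_or] at hxvy
    have hq : q ∉ b x := fun hq => hxvy.1 <| hb.injOn hx hv <|
      (eq_pair_of_mem_of_mem (hb.card_label hx) hpq hp hq).trans hbv.symm
    have hr : r ∉ b x := fun hr => hxvy.2 <| hb.injOn hx hy <|
      (eq_pair_of_mem_of_mem (hb.card_label hx) hpr hp hr).trans hby.symm
    refine ⟨fun hxw => hq (by simp [hxw, hbw]), ⟨hx, ?_⟩, hx, ?_⟩ <;> simp [hp, hq, hr]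

open scoped symmDiff

theorem exists_triangle [DecidableEq α] (hb : IsPairLabeling σ b n) {v w : α} (hv : v ∈ σ)
    (hw : w ∈ meeting σ b v 1) :
    ∃ y ∈ σ, b y = b v ∆ b w ∧ ∃ i ∈ Finset.Icc 1 n, ∃ j ∈ Finset.Icc 1 n, ∃ k ∈ Finset.Icc 1 n,
      b v = {i, j} ∧
      {v, y} ∪ (meeting σ b v 1 ∩ meeting σ b y 1).erase w = star σ b i ∧
      {v, w} ∪ (meeting σ b v 1 ∩ meeting σ b w 1).erase y = star σ b j ∧
      {w, y} ∪ (meeting σ b w 1 ∩ meeting σ b y 1).erase v = star σ b k := by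
  obtain ⟨hw, hvw⟩ := mem_meeting.1 hw
  obtain ⟨y, hy, hby⟩ := hb.surjOn (symmDiff_mem_twoSubsets (hb.mapsTo hv) (hb.mapsTo hw) hvw)
  obtain ⟨j, i, k, hji, hjk, hik, hbv, hbw⟩ :=
    exists_eq_pair_eq_pair_of_card_inter_eq_one (hb.card_label hv) (hb.card_label hw) hvw
  have hby' : b y = {i, k} := eq_pair_of_mem_of_mem (hb.card_label hy) hik
    (by simp [hby, hbv, hbw, Finset.mem_symmDiff, hji.symm, hik])
    (by simp [hby, hbv, hbw, Finset.mem_symmDiff, hjk.symm, hik.symm])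
  have hbv' : b v = {i, j} := hbv.trans (Finset.pair_comm j i)
  refine ⟨y, hy, hby, i, hb.label_subset hv (by simp [hbv]), j, hb.label_subset hv (by simp [hbv]),
    k, hb.label_subset hw (by simp [hbw]), hbv', ?_, ?_, ?_⟩
  · exact hb.pair_union_eq_star hv hw hy hji.symm hik hjk hbv' hby' hbw
  · exact hb.pair_union_eq_star hv hy hw hji hjk hik hbv hbw hby'
  · exact hb.pair_union_eq_star hw hv hy hjk.symm hik.symm hji
      (hbw.trans (Finset.pair_comm j k)) (hby'.trans (Finset.pair_comm i k)) hbv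

end IsPairLabeling

end PairLabeling

/-! ### Induced permutations and their expansions -/

section InducedPermutations

variable {V : Type u} {F : Formula V} {σ : Finset (Lit V)} {b : Lit V → Finset ℕ} {n : ℕ}
  {τ : Equiv.Perm ℕ} {f g : Lit V → Lit V} {l : Lit V}

/-- The map `f` commutes with negation, acts on `σ` as prescribed by `τ` through the labeling `b`,
and fixes every literal outside `σ ∪ ¬σ`. Such an `f` is unique, so these laws characterize
`expand (inducedPerm σ b τ)`. -/
structure IsInducedBy (σ : Finset (Lit V)) (b : Lit V → Finset ℕ) (τ : Equiv.Perm ℕ)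
    (f : Lit V → Lit V) : Prop where
  apply_mem : ∀ l ∈ σ, f l ∈ σ
  label_apply : ∀ l ∈ σ, b (f l) = (b l).image τ
  map_neg : ∀ l, f (neg l) = neg (f l)
  apply_eq_self : ∀ l, l ∉ σ → neg l ∉ σ → f l = l

theorem inducedPerm_spec (hb : IsPairLabeling σ b n) (hτ : τ ∈ symGroup n) (hl : l ∈ σ) :
    inducedPerm σ b τ l ∈ σ ∧ b (inducedPerm σ b τ l) = (b l).image τ := by
  have exists_image : l ∈ σ ∧ ∃ x ∈ σ, b x = (b l).image τ :=
    ⟨hl, hb.surjOn (image_mem_twoSubsets hτ (hb.mapsTo hl))⟩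
  rw [inducedPerm, dif_pos exists_image]
  exact exists_image.2.choose_spec

theorem inducedPerm_of_notMem (hl : l ∉ σ) : inducedPerm σ b τ l = l := dif_neg fun h => hl h.1

theorem expand_inducedPerm_of_mem (hσ : ∀ l ∈ σ, neg l ∉ σ) (hl : l ∈ σ) :
    expand (inducedPerm σ b τ) l = inducedPerm σ b τ l := by
  rw [expand, inducedPerm_of_notMem (hσ l hl)]
  by_cases h : inducedPerm σ b τ l = l <;> simp [h]

theorem expand_inducedPerm_of_neg_mem (hσ : ∀ l ∈ σ, neg l ∉ σ) (hl : neg l ∈ σ) :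
    expand (inducedPerm σ b τ) l = neg (inducedPerm σ b τ (neg l)) := by
  rw [expand, inducedPerm_of_notMem (l := l) fun h => hσ l h hl]
  by_cases h : inducedPerm σ b τ (neg l) = neg l <;> simp [h, neg_neg]

theorem expand_inducedPerm_of_notMem (hl : l ∉ σ) (hl' : neg l ∉ σ) :
    expand (inducedPerm σ b τ) l = l := by
  simp [expand, inducedPerm_of_notMem hl, inducedPerm_of_notMem hl']

theorem expand_inducedPerm_neg (hσ : ∀ l ∈ σ, neg l ∉ σ) (l : Lit V) :
    expand (inducedPerm σ b τ) (neg l) = neg (expand (inducedPerm σ b τ) l) := by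
  by_cases hl : l ∈ σ
  · rw [expand_inducedPerm_of_mem hσ hl, expand_inducedPerm_of_neg_mem hσ (by rwa [neg_neg]),
      neg_neg]
  by_cases hl' : neg l ∈ σ
  · rw [expand_inducedPerm_of_mem hσ hl', expand_inducedPerm_of_neg_mem hσ hl', neg_neg]
  · rw [expand_inducedPerm_of_notMem hl hl', expand_inducedPerm_of_notMem hl' (by rwa [neg_neg])]

theorem isInducedBy_expand (hb : IsPairLabeling σ b n) (hσ : ∀ l ∈ σ, neg l ∉ σ)
    (hτ : τ ∈ symGroup n) : IsInducedBy σ b τ (expand (inducedPerm σ b τ)) where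
  apply_mem l hl := by
    rw [expand_inducedPerm_of_mem hσ hl]
    exact (inducedPerm_spec hb hτ hl).1
  label_apply l hl := by
    rw [expand_inducedPerm_of_mem hσ hl]
    exact (inducedPerm_spec hb hτ hl).2
  map_neg := expand_inducedPerm_neg hσ
  apply_eq_self _ := expand_inducedPerm_of_notMem

namespace IsInducedBy

theorem eq (hf : IsInducedBy σ b τ f) (hg : IsInducedBy σ b τ g) (hb : Set.InjOn b σ) :
    f = g := by
  have eqOn : ∀ l ∈ σ, f l = g l := fun l hl =>
    hb (hf.apply_mem l hl) (hg.apply_mem l hl)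
      ((hf.label_apply l hl).trans (hg.label_apply l hl).symm)
  funext l
  by_cases hl : l ∈ σ
  · exact eqOn l hl
  by_cases hl' : neg l ∈ σ
  · exact neg_injective (by rw [← hf.map_neg, ← hg.map_neg, eqOn _ hl'])
  · rw [hf.apply_eq_self l hl hl', hg.apply_eq_self l hl hl']

protected theorem id : IsInducedBy σ b 1 id where
  apply_mem _ hl := hl
  label_apply _ _ := by rw [Equiv.Perm.coe_one, Finset.image_id, id]
  map_neg _ := rfl
  apply_eq_self _ _ _ := rfl

protected theorem comp {τ₁ τ₂ : Equiv.Perm ℕ} (hf : IsInducedBy σ b τ₁ f)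
    (hg : IsInducedBy σ b τ₂ g) : IsInducedBy σ b (τ₁ * τ₂) (f ∘ g) where
  apply_mem l hl := hf.apply_mem _ (hg.apply_mem l hl)
  label_apply l hl := by
    rw [Function.comp_apply, hf.label_apply _ (hg.apply_mem l hl), hg.label_apply l hl,
      Finset.image_image, Equiv.Perm.coe_mul]
  map_neg l := by simp only [Function.comp_apply, hg.map_neg, hf.map_neg]
  apply_eq_self l hl hl' := by
    rw [Function.comp_apply, hg.apply_eq_self l hl hl', hf.apply_eq_self l hl hl']

theorem of_conj {ρ : Equiv.Perm ℕ} {c : Lit V → Finset ℕ} (hf : IsInducedBy σ b (τ⁻¹ * ρ * τ) f)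
    (hc : ∀ l ∈ σ, c l = (b l).image τ) : IsInducedBy σ c ρ f where
  apply_mem := hf.apply_mem
  label_apply l hl := by
    have conj : τ * (τ⁻¹ * ρ * τ) = ρ * τ := by group
    rw [hc _ (hf.apply_mem l hl), hf.label_apply l hl, hc l hl, Finset.image_image,
      Finset.image_image, ← Equiv.Perm.coe_mul, conj, Equiv.Perm.coe_mul]
  map_neg := hf.map_neg
  apply_eq_self := hf.apply_eq_self

end IsInducedBy

theorem isSymmetry_id : IsSymmetry F id := (Aut F).one_mem

theorem IsSymmetry.comp (hf : IsSymmetry F f) (hg : IsSymmetry F g) : IsSymmetry F (f ∘ g) :=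
  have mul_mem : Equiv.ofBijective f hf.1 * Equiv.ofBijective g hg.1 ∈ Aut F :=
    (Aut F).mul_mem hf hg
  mul_mem

/-- The permutations of the points that induce a symmetry of `F` through the labeling `b`. -/
def inducingSubmonoid (F : Formula V) (σ : Finset (Lit V)) (b : Lit V → Finset ℕ) :
    Submonoid (Equiv.Perm ℕ) where
  carrier := {τ | ∃ f, IsInducedBy σ b τ f ∧ IsSymmetry F f}
  one_mem' := ⟨id, .id, isSymmetry_id⟩
  mul_mem' := by
    rintro _ _ ⟨f, hf, hfF⟩ ⟨g, hg, hgF⟩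
    exact ⟨f ∘ g, hf.comp hg, hfF.comp hgF⟩

theorem isSymmetry_expand_iff (hb : IsPairLabeling σ b n) (hσ : ∀ l ∈ σ, neg l ∉ σ)
    (hτ : τ ∈ symGroup n) :
    IsSymmetry F (expand (inducedPerm σ b τ)) ↔ τ ∈ inducingSubmonoid F σ b := by
  refine ⟨fun h => ⟨_, isInducedBy_expand hb hσ hτ, h⟩, ?_⟩
  rintro ⟨f, hf, hfF⟩
  rwa [(isInducedBy_expand hb hσ hτ).eq hf hb.injOn]

theorem isSymmetry_expand_of_swap_succ (hb : IsPairLabeling σ b n) (hσ : ∀ l ∈ σ, neg l ∉ σ)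
    (hswap : ∀ i ∈ Finset.Icc 1 (n - 1),
      IsSymmetry F (expand (inducedPerm σ b (Equiv.swap i (i + 1))))) (hτ : τ ∈ symGroup n) :
    IsSymmetry F (expand (inducedPerm σ b τ)) :=
  (isSymmetry_expand_iff hb hσ hτ).2 <| mem_of_swap_succ_mem (fun i hi =>
    (isSymmetry_expand_iff hb hσ (swap_succ_mem_symGroup hi)).1 (hswap i hi)) hτ

end InducedPermutations

/-! ### Johnson symmetry -/

section Restriction

variable {V : Type u} {F : Formula V}

theorem mk_apply_eq_of_apply_eq_self {α : Type*} {P : Setoid α} {c : Quotient P}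
    {g : Equiv.Perm α} (hg : ∀ x, Quotient.mk P x ≠ c → g x = x) (x : α) :
    Quotient.mk P (g x) = Quotient.mk P x := by
  by_cases hx : Quotient.mk P x = c
  · by_contra hgx
    exact hgx (congrArg _ (g.injective (hg _ fun h => hgx (h.trans hx.symm))))
  · rw [hg x hx]

namespace IsDisjointDirectDecomposition

variable {P : Setoid (Lit V)} {g : Equiv.Perm (Lit V)}

theorem mk_apply_eq (hP : IsDisjointDirectDecomposition F P) (hg : g ∈ Aut F) (l : Lit V) :
    Quotient.mk P (g l) = Quotient.mk P l := by
  obtain ⟨A, hA, hsup⟩ := hP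
  rw [← hsup] at hg
  induction hg using Subgroup.iSup_induction' generalizing l with
  | h1 => rfl
  | hmul g₁ g₂ _ _ ih₁ ih₂ => exact (ih₁ (g₂ l)).trans (ih₂ l)
  | hp c g hg => exact mk_apply_eq_of_apply_eq_self (hA c g hg) l

theorem exists_restrict (hP : IsDisjointDirectDecomposition F P) (hg : g ∈ Aut F)
    (c : Quotient P) :
    ∃ h ∈ Aut F, (∀ l, Quotient.mk P l = c → h l = g l) ∧ ∀ l, Quotient.mk P l ≠ c → h l = l := by
  have mk_apply_eq {g} (hg : g ∈ Aut F) := hP.mk_apply_eq hg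
  obtain ⟨A, hA, hsup⟩ := hP
  have le_Aut (d : Quotient P) : A d ≤ Aut F := hsup ▸ le_iSup A d
  rw [← hsup] at hg
  induction hg using Subgroup.iSup_induction' with
  | h1 => exact ⟨1, one_mem _, fun _ _ => rfl, fun _ _ => rfl⟩
  | hmul g₁ g₂ _ hg₂ ih₁ ih₂ =>
    obtain ⟨h₁, hh₁, eqOn₁, fix₁⟩ := ih₁
    obtain ⟨h₂, hh₂, eqOn₂, fix₂⟩ := ih₂
    refine ⟨h₁ * h₂, mul_mem hh₁ hh₂, fun l hl => ?_, fun l hl => ?_⟩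
    · rw [Equiv.Perm.mul_apply, Equiv.Perm.mul_apply, eqOn₂ l hl,
        eqOn₁ _ ((mk_apply_eq (hsup ▸ hg₂) l).trans hl)]
    · rw [Equiv.Perm.mul_apply, fix₂ l hl, fix₁ l hl]
  | hp d g hg =>
    by_cases hd : d = c
    · exact ⟨g, le_Aut d hg, fun _ _ => rfl, fun l hl => hA d g hg l (hd ▸ hl)⟩
    · exact ⟨1, one_mem _, fun l hl => (hA d g hg l fun h => hd (h.symm.trans hl)).symm,
        fun _ _ => rfl⟩

end IsDisjointDirectDecomposition

theorem IsDisjointDirectFactor.exists_restrict {L : Set (Lit V)} {g : Equiv.Perm (Lit V)}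
    (hL : IsDisjointDirectFactor F L) (hg : g ∈ Aut F) :
    ∃ h ∈ Aut F, (∀ l ∈ L, h l = g l) ∧ ∀ l ∉ L, h l = l := by
  obtain ⟨P, ⟨hP, -⟩, x, rfl⟩ := hL
  have mem_class_iff (l : Lit V) : l ∈ {y | P y x} ↔ Quotient.mk P l = Quotient.mk P x :=
    Quotient.eq.symm
  simpa only [mem_class_iff] using hP.exists_restrict hg (Quotient.mk P x)

end Restriction

namespace ExhibitsJohnson

variable {V : Type u} {F : Formula V} {σ : Finset (Lit V)} {b : Lit V → Finset ℕ} {n : ℕ}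

theorem isPairLabeling (hJ : ExhibitsJohnson F σ n b) : IsPairLabeling σ b n := hJ.bij

theorem apply_mem (hJ : ExhibitsJohnson F σ n b) {g : Equiv.Perm (Lit V)} (hg : g ∈ Aut F)
    {l : Lit V} (hl : l ∈ σ) : g l ∈ σ := by
  obtain ⟨l₀, orbit_eq⟩ := hJ.orbit
  rw [← Finset.mem_coe, orbit_eq] at hl ⊢
  exact MulAction.mem_orbit_of_mem_orbit (⟨g, hg⟩ : Aut F) hl

theorem apply_eq_iff (hJ : ExhibitsJohnson F σ n b) {g : Equiv.Perm (Lit V)} (hg : g ∈ Aut F)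
    {x y : Lit V} (hx : x ∈ σ) (hy : y ∈ σ) : g x = y ↔ b (g x) = b y :=
  (hJ.bij.injOn.eq_iff (hJ.apply_mem hg hx) hy).symm

theorem neg_notMem (hJ : ExhibitsJohnson F σ n b) (hn : 5 ≤ n) : ∀ l ∈ σ, neg l ∉ σ := by
  -- A symmetry fixing `l` fixes `neg l`, but some `τ` fixes the label of `l` and moves the other.
  intro l hl hl'
  have card_label := hJ.isPairLabeling.card_label hl
  have card_label_neg := hJ.isPairLabeling.card_label hl'
  have not_subset : ¬ b (neg l) ⊆ b l := fun h =>
    neg_ne l (hJ.bij.injOn hl' hl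
      (Finset.eq_of_subset_of_card_le h (by rw [card_label, card_label_neg])))
  have card_lt : (b l ∪ b (neg l)).card < n :=
    (Finset.card_union_le _ _).trans_lt (by rw [card_label, card_label_neg]; omega)
  obtain ⟨τ, hτ, hfix, hne⟩ :=
    exists_mem_symGroup_image_ne (hJ.isPairLabeling.label_subset hl') not_subset card_lt
  obtain ⟨g, hg, hgb⟩ := hJ.full τ hτ
  have hgl : g l = l := (hJ.apply_eq_iff hg hl hl).2
    ((hgb l hl).trans ((Finset.image_congr hfix).trans Finset.image_id))
  exact hne (by rw [← hgb _ hl', hg.2.1, hgl])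

theorem exists_stabilizer_apply_eq_iff (hJ : ExhibitsJohnson F σ n b) {vs : List (Lit V)}
    (hvs : ∀ v ∈ vs, v ∈ σ) {x y : Lit V} (hx : x ∈ σ) (hy : y ∈ σ) :
    (∃ g ∈ Aut F, (∀ v ∈ vs, g v = v) ∧ g x = y) ↔
      ∃ τ ∈ symGroup n, (∀ v ∈ vs, (b v).image τ = b v) ∧ (b x).image τ = b y := by
  constructor
  · rintro ⟨g, hg, hfix, hgx⟩
    obtain ⟨τ, hτ, hgb⟩ := hJ.act g hg
    exact ⟨τ, hτ, fun v hv => by rw [← hgb v (hvs v hv), hfix v hv], by rw [← hgb x hx, hgx]⟩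
  · rintro ⟨τ, hτ, hfix, hτx⟩
    obtain ⟨g, hg, hgb⟩ := hJ.full τ hτ
    exact ⟨g, hg, fun v hv => (hJ.apply_eq_iff hg (hvs v hv) (hvs v hv)).2
      ((hgb v (hvs v hv)).trans (hfix v hv)), (hJ.apply_eq_iff hg hx hy).2 ((hgb x hx).trans hτx)⟩

theorem exists_isInducedBy (hJ : ExhibitsJohnson F σ n b) {τ : Equiv.Perm ℕ}
    (hτ : τ ∈ symGroup n) : ∃ f, IsInducedBy σ b τ f ∧ IsSymmetry F f := by
  obtain ⟨g, hg, hgb⟩ := hJ.full τ hτ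
  obtain ⟨h, hh, eqOn, hfix⟩ := hJ.factor.exists_restrict hg
  refine ⟨h, ⟨fun l hl => hJ.apply_mem hh hl, fun l hl => ?_, hh.2.1, fun l hl hl' => ?_⟩, hh⟩
  · rw [eqOn l (Or.inl hl), hgb l hl]
  · refine hfix l ?_
    rintro (hlσ | ⟨l', hl'σ, rfl⟩)
    · exact hl hlσ
    · exact hl' (by rwa [neg_neg])

theorem verified (hJ : ExhibitsJohnson F σ n b) (hσ : ∀ l ∈ σ, neg l ∉ σ) {τ : Equiv.Perm ℕ}
    (hτ : τ ∈ symGroup n) {label : Lit V → List ℕ}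
    (hlabel : ∀ l ∈ σ, labelSet label l = (b l).image τ) : Verified F σ n label := by
  have labeling : IsPairLabeling σ (labelSet label) n :=
    (hJ.isPairLabeling.comp_image hτ).congr fun l hl => (hlabel l hl).symm
  refine ⟨labeling, fun i hi => ?_⟩
  have hswap := swap_succ_mem_symGroup hi
  obtain ⟨f, hf, hfF⟩ := hJ.exists_isInducedBy (mul_mem (mul_mem (inv_mem hτ) hswap) hτ)
  exact (isSymmetry_expand_iff labeling hσ hswap).2 ⟨f, hf.of_conj hlabel, hfF⟩

end ExhibitsJohnson

/-! ### Fragments -/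

section Fragments

variable {V : Type u} {F : Formula V} {σ : Finset (Lit V)}

open scoped Classical in
theorem fragments_eq_image_fiber {ι : Type*} [DecidableEq ι] {π : Vertex F → ℕ} {f : Lit V → ι}
    (hf : ∀ x ∈ σ, ∀ y ∈ σ, π (.inl x) = π (.inl y) ↔ f x = f y) :
    fragments F σ π = (σ.image f).image fun c => σ.filter (f · = c) := by
  rw [Finset.image_image]
  exact Finset.image_congr fun x hx => Finset.filter_congr fun y hy => hf y hy x hx

theorem singleton_mem_fragments_iff {π : Vertex F → ℕ} {y : Lit V} :
    {y} ∈ fragments F σ π ↔ y ∈ σ ∧ ∀ x ∈ σ, π (.inl x) = π (.inl y) → x = y := by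
  classical
  simp only [fragments, Finset.mem_image, Finset.eq_singleton_iff_unique_mem, Finset.mem_filter,
    and_imp]
  constructor
  · rintro ⟨x, -, ⟨hy, hyx⟩, unique⟩
    exact ⟨hy, fun z hz hzy => unique z hz (hzy.trans hyx)⟩
  · rintro ⟨hy, unique⟩
    exact ⟨y, hy, ⟨hy, rfl⟩, unique⟩

variable {v : Lit V} {S T : Finset (Lit V)}

open scoped Classical in
theorem card_insert_singleton_pair (hS : 1 < S.card) (hST : S.card < T.card) :
    ({{v}, S, T} : Finset (Finset (Lit V))).card = 3 := by
  refine Finset.card_eq_three.2 ⟨_, _, _, fun h => ?_, fun h => ?_, fun h => ?_, rfl⟩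
  · rw [← h, Finset.card_singleton] at hS
    exact lt_irrefl 1 hS
  · rw [← h, Finset.card_singleton] at hST
    exact hS.not_gt hST
  · exact hST.ne (congrArg Finset.card h)

open scoped Classical in
theorem smallerFragments_insert_singleton_pair (hS : 1 < S.card) (hST : S.card < T.card) :
    smallerFragments {{v}, S, T} = {S} := by
  ext R
  simp only [smallerFragments, Finset.mem_filter, Finset.mem_insert, Finset.mem_singleton,
    forall_eq_or_imp, forall_eq, Finset.card_singleton, lt_irrefl, false_imp_iff, true_and]
  constructor
  · rintro ⟨rfl | rfl | rfl, one_lt, le_S, -⟩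
    · exact absurd one_lt (by simp)
    · rfl
    · exact absurd (le_S hS) hST.not_ge
  · rintro rfl
    exact ⟨.inr (.inl rfl), hS, fun _ => le_rfl, fun _ => hST.le⟩

open scoped Classical in
theorem explore_eq_some [Fintype V] (ch : Choices V) (s : State V) (ad : Lit V → Finset (Lit V))
    {x : Lit V} (hQ : fragments F σ (irColoring F [x]) = {{v}, S, T}) (hS : 1 < S.card)
    (hST : S.card < T.card) :
    explore ch F σ s ad x = some (Function.update ad x (ad x ∪ S)) := by
  have smaller_eq : smallerFragments (fragments F σ (irColoring F [x])) = {S} := by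
    rw [hQ, smallerFragments_insert_singleton_pair hS hST]
  have smaller_nonempty := smaller_eq ▸ Finset.singleton_nonempty S
  have chosen_eq := Finset.mem_singleton.1
    (smaller_eq.le (ch.fragment s x _ smaller_nonempty).2)
  have card_eq : (fragments F σ (irColoring F [x])).card = 3 := by
    rw [hQ, card_insert_singleton_pair hS hST]
  rw [← chosen_eq]
  exact (if_pos card_eq).trans (dif_pos smaller_nonempty)

end Fragments

/-! ### Fragments of a Johnson orbit -/

namespace ExhibitsJohnson

variable {V : Type u} [Fintype V] {F : Formula V} {σ : Finset (Lit V)} {b : Lit V → Finset ℕ}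
  {n : ℕ} {v w x y : Lit V}

theorem irColoring_eq_iff (hJ : ExhibitsJohnson F σ n b)
    (hT : IsTinhofer (modelGraph F) (modelColoring F)) {vs : List (Lit V)} (hvs : vs ≠ [])
    (hvsσ : ∀ v ∈ vs, v ∈ σ) (hx : x ∈ σ) (hy : y ∈ σ) :
    irColoring F vs (.inl x) = irColoring F vs (.inl y) ↔
      ∃ τ ∈ symGroup n, (∀ v ∈ vs, (b v).image τ = b v) ∧ (b x).image τ = b y :=
  (hT.irColoring_eq_iff hvs).trans (hJ.exists_stabilizer_apply_eq_iff hvsσ hx hy)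

open scoped Classical in
theorem fragments_irColoring_eq (hJ : ExhibitsJohnson F σ n b)
    (hT : IsTinhofer (modelGraph F) (modelColoring F)) (hn : 4 ≤ n) (hv : v ∈ σ) :
    fragments F σ (irColoring F [v]) = {{v}, meeting σ b v 1, meeting σ b v 0} := by
  have labeling := hJ.isPairLabeling
  have color_eq_iff (x) (hx : x ∈ σ) (y) (hy : y ∈ σ) :
      irColoring F [v] (.inl x) = irColoring F [v] (.inl y) ↔
        (b v ∩ b x).card = (b v ∩ b y).card := by
    rw [hJ.irColoring_eq_iff hT (List.cons_ne_nil _ _) (List.forall_mem_singleton.2 hv) hx hy,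
      ← exists_image_eq_iff_card_inter_eq (labeling.label_subset hv) (labeling.label_subset hx)
        (labeling.label_subset hy) ((labeling.card_label hx).trans (labeling.card_label hy).symm)]
    simp only [List.forall_mem_singleton]
  have mem_image (c : ℕ) (hc : 0 < (meeting σ b v c).card) :
      c ∈ σ.image fun x => (b v ∩ b x).card := by
    obtain ⟨x, hx⟩ := Finset.card_pos.1 hc
    exact Finset.mem_image.2 ⟨x, mem_meeting.1 hx⟩
  have card_inter_image : (σ.image fun x => (b v ∩ b x).card) = {2, 1, 0} := by
    refine Finset.Subset.antisymm (fun c hc => ?_) ?_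
    · obtain ⟨x, -, rfl⟩ := Finset.mem_image.1 hc
      have := labeling.card_inter_lt_three hv x
      simp only [Finset.mem_insert, Finset.mem_singleton]
      omega
    · simp only [Finset.insert_subset_iff, Finset.singleton_subset_iff]
      refine ⟨mem_image 2 ?_, mem_image 1 ?_, mem_image 0 ?_⟩
      · rw [labeling.meeting_two hv, Finset.card_singleton]
        exact one_pos
      · rw [labeling.card_meeting_one (by omega) hv]
        omega
      · rw [labeling.card_meeting_zero hv]
        exact Nat.choose_pos (by omega)
  rw [fragments_eq_image_fiber color_eq_iff, card_inter_image, ← labeling.meeting_two hv,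
    Finset.image_insert, Finset.image_insert, Finset.image_singleton]
  rfl

theorem singleton_mem_fragments_irColoring_iff (hJ : ExhibitsJohnson F σ n b)
    (hT : IsTinhofer (modelGraph F) (modelColoring F)) {vs : List (Lit V)} (hvs : vs ≠ [])
    (hvsσ : ∀ v ∈ vs, v ∈ σ) (hy : y ∈ σ) :
    {y} ∈ fragments F σ (irColoring F vs) ↔
      ∀ τ ∈ symGroup n, (∀ v ∈ vs, (b v).image τ = b v) → (b y).image τ = b y := by
  rw [singleton_mem_fragments_iff]
  constructor
  · rintro ⟨-, unique⟩ τ hτ hfix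
    obtain ⟨x, hx, hxy⟩ := hJ.bij.surjOn (image_mem_twoSubsets hτ (hJ.bij.mapsTo hy))
    have same_color := (hJ.irColoring_eq_iff hT hvs hvsσ hy hx).2 ⟨τ, hτ, hfix, hxy.symm⟩
    rw [← hxy, unique x hx same_color.symm]
  · refine fun hfix => ⟨hy, fun x hx hxy => ?_⟩
    obtain ⟨τ, hτ, hτvs, hτy⟩ := (hJ.irColoring_eq_iff hT hvs hvsσ hy hx).1 hxy.symm
    exact hJ.bij.injOn hx hy (hτy.symm.trans (hfix τ hτ hτvs))

open scoped symmDiff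

theorem thirdSingletons_eq (hJ : ExhibitsJohnson F σ n b)
    (hT : IsTinhofer (modelGraph F) (modelColoring F)) (hn : 6 ≤ n) (hv : v ∈ σ) (hw : w ∈ σ)
    (hy : y ∈ σ) (hvw : (b v ∩ b w).card = 1) (hbyvw : b y = b v ∆ b w) :
    thirdSingletons F σ v w = {y} := by
  have labeling := hJ.isPairLabeling
  have mem_fragments_iff (x) (hx : x ∈ σ) (hxv : x ≠ v) (hxw : x ≠ w) :
      {x} ∈ fragments F σ (irColoring F [v, w]) ↔ x = y := by
    rw [hJ.singleton_mem_fragments_irColoring_iff hT (List.cons_ne_nil _ _) (by simp [hv, hw]) hx,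
      ← hJ.bij.injOn.eq_iff hx hy, hbyvw, ← forall_image_eq_iff_eq_symmDiff hn
        (labeling.card_label hv) (labeling.card_label hw) (labeling.mapsTo hx) hvw
        (mt (hJ.bij.injOn hx hv) hxv) (mt (hJ.bij.injOn hx hw) hxw)]
    simp
  have hyv : y ≠ v := by
    rintro rfl
    have := labeling.card_label hw
    simp [symmDiff_eq_left.1 hbyvw.symm] at this
  have hyw : y ≠ w := by
    rintro rfl
    have := labeling.card_label hv
    simp [symmDiff_eq_right.1 hbyvw.symm] at this
  ext x
  simp only [thirdSingletons, Finset.mem_filter, Finset.mem_singleton]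
  constructor
  · rintro ⟨hx, hxv, hxw, hfrag⟩
    exact (mem_fragments_iff x hx hxv hxw).1 hfrag
  · rintro rfl
    exact ⟨hy, hyv, hyw, (mem_fragments_iff x hy hyv hyw).2 rfl⟩

open scoped Classical in
theorem explore_eq_some (hJ : ExhibitsJohnson F σ n b)
    (hT : IsTinhofer (modelGraph F) (modelColoring F)) (hn : 8 ≤ n) (hv : v ∈ σ)
    (ch : Choices V) (s : State V) (ad : Lit V → Finset (Lit V)) :
    explore ch F σ s ad v = some (Function.update ad v (ad v ∪ meeting σ b v 1)) := by
  refine JohnsonSym.explore_eq_some ch s ad (hJ.fragments_irColoring_eq hT (by omega) hv) ?_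
    (hJ.isPairLabeling.card_meeting_one_lt hn hv)
  rw [hJ.isPairLabeling.card_meeting_one (by omega) hv]
  omega

end ExhibitsJohnson

/-! ### The labels in the main loop -/

section Labels

variable {V : Type u} {σ : Finset (Lit V)} {b : Lit V → Finset ℕ} {n : ℕ} {s : State V}
  {D : Finset ℕ} {f : ℕ → ℕ} {x : Lit V} {p : ℕ}

/-- The loop invariant for the labels: the points in `D` have been named `1, …, vnr - 1` by `f`, and
`label[x]` lists the names of the points in `D` that belong to the label of `x`. -/
structure LabelInvariant (σ : Finset (Lit V)) (b : Lit V → Finset ℕ) (n : ℕ) (s : State V)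
    (D : Finset ℕ) (f : ℕ → ℕ) : Prop where
  subset : D ⊆ Finset.Icc 1 n
  vnr_eq : s.vnr = D.card + 1
  injOn : Set.InjOn f D
  mapsTo : ∀ p ∈ D, f p ∈ Finset.Icc 1 D.card
  nodup : ∀ x ∈ σ, (s.label x).Nodup
  toFinset_label : ∀ x ∈ σ, (s.label x).toFinset = (b x ∩ D).image f

theorem mark_ad (s : State V) (E : Finset (Lit V)) : (mark s E).ad = s.ad := by
  unfold mark
  split_ifs <;> rfl

namespace LabelInvariant

theorem mem_label_iff (hs : LabelInvariant σ b n s D f) (hx : x ∈ σ) {k : ℕ} :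
    k ∈ s.label x ↔ ∃ p ∈ b x ∩ D, f p = k := by
  rw [← List.mem_toFinset, hs.toFinset_label x hx, Finset.mem_image]

theorem length_label (hs : LabelInvariant σ b n s D f) (hx : x ∈ σ) :
    (s.label x).length = (b x ∩ D).card := by
  rw [← List.toFinset_card_of_nodup (hs.nodup x hx), hs.toFinset_label x hx,
    Finset.card_image_of_injOn (hs.injOn.mono (Finset.coe_subset.2 Finset.inter_subset_right))]

theorem lt_vnr (hs : LabelInvariant σ b n s D f) (hp : p ∈ D) : f p < s.vnr := by
  rw [hs.vnr_eq, Nat.lt_succ_iff]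
  exact (Finset.mem_Icc.1 (hs.mapsTo p hp)).2

theorem vnr_notMem_label (hs : LabelInvariant σ b n s D f) (hx : x ∈ σ) :
    s.vnr ∉ s.label x := by
  rw [hs.mem_label_iff hx]
  rintro ⟨p, hp, hpvnr⟩
  exact (hs.lt_vnr (Finset.mem_inter.1 hp).2).ne hpvnr

theorem exists_common_label_iff (hs : LabelInvariant σ b n s D f) (hb : IsPairLabeling σ b n)
    (hn : 3 ≤ n) (hp : p ∈ Finset.Icc 1 n) :
    (∃ k, ∀ x ∈ star σ b p, k ∈ s.label x) ↔ p ∈ D := by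
  constructor
  · rintro ⟨k, hk⟩
    obtain ⟨x, hx, y, hy, inter_eq⟩ := hb.exists_inter_eq_singleton hn hp
    obtain ⟨q, hq, rfl⟩ := (hs.mem_label_iff (mem_star.1 hx).1).1 (hk x hx)
    obtain ⟨r, hr, hrq⟩ := (hs.mem_label_iff (mem_star.1 hy).1).1 (hk y hy)
    rw [Finset.mem_inter] at hq hr
    obtain rfl := hs.injOn hr.2 hq.2 hrq
    have hrp : r ∈ ({p} : Finset ℕ) := inter_eq ▸ Finset.mem_inter.2 ⟨hq.1, hr.1⟩
    exact Finset.mem_singleton.1 hrp ▸ hr.2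
  · intro hpD
    refine ⟨f p, fun x hx => ?_⟩
    rw [mem_star] at hx
    exact (hs.mem_label_iff hx.1).2 ⟨p, Finset.mem_inter.2 ⟨hx.2, hpD⟩, rfl⟩

open scoped Classical in
theorem append_vnr (hs : LabelInvariant σ b n s D f) (hp : p ∈ Finset.Icc 1 n) (hpD : p ∉ D) :
    LabelInvariant σ b n
      { s with
        label := fun x => if x ∈ star σ b p then s.label x ++ [s.vnr] else s.label x
        vnr := s.vnr + 1 }
      (insert p D) (Function.update f p s.vnr) := by
  have update_eq (q) (hq : q ∈ D) : Function.update f p s.vnr q = f q :=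
    Function.update_of_ne (ne_of_mem_of_not_mem hq hpD) _ _
  have image_update (x) : (b x ∩ D).image (Function.update f p s.vnr) = (b x ∩ D).image f :=
    Finset.image_congr fun q hq => update_eq q (Finset.mem_inter.1 hq).2
  have card_insert := Finset.card_insert_of_notMem hpD
  refine ⟨Finset.insert_subset hp hs.subset, by rw [card_insert, hs.vnr_eq], ?_, ?_, ?_, ?_⟩
  · rw [Finset.coe_insert, Set.injOn_insert (Finset.mem_coe.not.2 hpD), Function.update_self]
    refine ⟨hs.injOn.congr fun q hq => (update_eq q hq).symm, ?_⟩
    rintro ⟨q, hq, hqvnr⟩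
    exact (hs.lt_vnr hq).ne ((update_eq q hq).symm.trans hqvnr)
  · rw [Finset.forall_mem_insert, Function.update_self, card_insert, ← hs.vnr_eq]
    refine ⟨Finset.right_mem_Icc.2 (hs.vnr_eq ▸ Nat.le_add_left 1 _), fun q hq => ?_⟩
    rw [update_eq q hq, hs.vnr_eq]
    exact Finset.Icc_subset_Icc_right (Nat.le_succ _) (hs.mapsTo q hq)
  · intro x hx
    dsimp only
    split_ifs
    · exact (hs.nodup x hx).append (List.nodup_singleton _)
        (List.disjoint_singleton.2 (hs.vnr_notMem_label hx))
    · exact hs.nodup x hx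
  · intro x hx
    dsimp only
    split_ifs with hxp
    · rw [Finset.inter_insert_of_mem (mem_star.1 hxp).2, Finset.image_insert, image_update,
        Function.update_self, List.toFinset_append, hs.toFinset_label x hx, Finset.insert_eq,
        Finset.union_comm]
      rfl
    · rw [Finset.inter_insert_of_notMem fun h => hxp (mem_star.2 ⟨hx, h⟩), image_update,
        hs.toFinset_label x hx]

theorem mark_star (hs : LabelInvariant σ b n s D f) (hb : IsPairLabeling σ b n) (hn : 3 ≤ n)
    (hp : p ∈ Finset.Icc 1 n) :
    ∃ f', LabelInvariant σ b n (mark s (star σ b p)) (insert p D) f' := by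
  unfold mark
  rw [hs.exists_common_label_iff hb hn hp]
  split_ifs with hpD
  · exact ⟨f, by rwa [Finset.insert_eq_of_mem hpD]⟩
  · exact ⟨_, hs.append_vnr hp hpD⟩

theorem mark_stars (hs : LabelInvariant σ b n s D f) (hb : IsPairLabeling σ b n) (hn : 3 ≤ n)
    {i j k : ℕ} (hi : i ∈ Finset.Icc 1 n) (hj : j ∈ Finset.Icc 1 n) (hk : k ∈ Finset.Icc 1 n) :
    ∃ f', LabelInvariant σ b n (mark (mark (mark s (star σ b i)) (star σ b j)) (star σ b k))
      (D ∪ {i, j, k}) f' := by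
  obtain ⟨f₁, hs₁⟩ := hs.mark_star hb hn hi
  obtain ⟨f₂, hs₂⟩ := hs₁.mark_star hb hn hj
  obtain ⟨f₃, hs₃⟩ := hs₂.mark_star hb hn hk
  have insert_eq : insert k (insert j (insert i D)) = D ∪ {i, j, k} := by grind
  exact ⟨f₃, insert_eq ▸ hs₃⟩

theorem label_not_subset (hs : LabelInvariant σ b n s D f) (hb : IsPairLabeling σ b n)
    (hx : x ∈ unfinished σ s) : ¬ b x ⊆ D := by
  intro hxD
  obtain ⟨hx, length_le⟩ := Finset.mem_filter.1 hx
  rw [hs.length_label hx, Finset.inter_eq_left.2 hxD, hb.card_label hx] at length_le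
  omega

theorem eq_Icc_of_unfinished_eq_empty (hs : LabelInvariant σ b n s D f)
    (hb : IsPairLabeling σ b n) (hn : 3 ≤ n) (hfin : unfinished σ s = ∅) :
    D = Finset.Icc 1 n := by
  refine hs.subset.antisymm fun p hp => ?_
  obtain ⟨x, hx, -⟩ := hb.exists_inter_eq_singleton hn hp
  rw [mem_star] at hx
  have two_le : 2 ≤ (b x ∩ D).card := by
    rw [← hs.length_label hx.1]
    exact not_le.1 fun h => Finset.filter_eq_empty_iff.1 hfin hx.1 h
  have inter_eq : b x ∩ D = b x := Finset.eq_of_subset_of_card_le Finset.inter_subset_left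
    (by rwa [hb.card_label hx.1])
  exact Finset.inter_eq_left.1 inter_eq hx.2

theorem exists_perm (hs : LabelInvariant σ b n s (Finset.Icc 1 n) f)
    (hb : IsPairLabeling σ b n) :
    ∃ τ ∈ symGroup n, ∀ x ∈ σ, labelSet s.label x = (b x).image τ := by
  have card_Icc : (Finset.Icc 1 n).card = n := by simp
  obtain ⟨τ, hτ, hτf⟩ := exists_mem_symGroup_eqOn
    (fun k hk => card_Icc ▸ hs.mapsTo k hk) hs.injOn
  refine ⟨τ, hτ, fun x hx => ?_⟩
  rw [labelSet, hs.toFinset_label x hx, Finset.inter_eq_left.2 (hb.label_subset hx)]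
  exact Finset.image_congr fun k hk => (hτf k (hb.label_subset hx hk)).symm

end LabelInvariant

end Labels

/-! ### Termination of the main loop -/

section Loop

variable {V : Type u} [Fintype V] {ch : Choices V} {F : Formula V} {σ : Finset (Lit V)}
  {s s' : State V}

open scoped Classical in
theorem iteration_eq_some {v w y : Lit V} {ad₁ ad₂ ad : Lit V → Finset (Lit V)}
    {Ei Ej Ek : Finset (Lit V)} (explore_v : explore ch F σ s s.ad v = some ad₁)
    (hne : (ad₁ v).Nonempty) (hw : ch.neighbor s (ad₁ v) hne = w)
    (explore_w : explore ch F σ s ad₁ w = some ad₂) (hy : thirdSingletons F σ v w = {y})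
    (explore_y : explore ch F σ s ad₂ y = some ad) (hEi : {v, y} ∪ (ad v ∩ ad y).erase w = Ei)
    (hEj : {v, w} ∪ (ad v ∩ ad w).erase y = Ej) (hEk : {w, y} ∪ (ad w ∩ ad y).erase v = Ek)
    (hs' : mark (mark (mark { s with ad := ad } Ei) Ej) Ek = s') (hvnr : s'.vnr ≠ s.vnr) :
    iteration ch F σ s v = some s' := by
  subst hw hEi hEj hEk hs'
  have third_exists : ∃ y, thirdSingletons F σ v (ch.neighbor s (ad₁ v) hne) = {y} := ⟨y, hy⟩
  obtain rfl : third_exists.choose = y :=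
    Finset.singleton_injective (third_exists.choose_spec.symm.trans hy)
  simp only [iteration, explore_v, explore_w, explore_y, Option.bind_eq_bind, Option.bind_some,
    dif_pos hne, dif_pos third_exists, if_neg hvnr]

theorem mem_mainLoop_of_unfinished_eq_empty (hfin : unfinished σ s = ∅) :
    some s ∈ mainLoop ch F σ s := by
  refine PFun.mem_fix_iff.2 (.inl (Part.mem_some_iff.2 ?_))
  rw [loopStep, dif_neg (Finset.not_nonempty_iff_eq_empty.2 hfin)]

theorem mem_mainLoop_of_iteration_eq_some {r : Option (State V)}
    (hne : (unfinished σ s).Nonempty)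
    (hs' : iteration ch F σ s (ch.vertex s (unfinished σ s) hne) = some s')
    (hr : r ∈ mainLoop ch F σ s') : r ∈ mainLoop ch F σ s := by
  refine PFun.mem_fix_iff.2 (.inr ⟨s', Part.mem_some_iff.2 ?_, hr⟩)
  rw [loopStep, dif_pos hne, hs']

namespace ExhibitsJohnson

variable {b : Lit V → Finset ℕ} {n : ℕ} {D : Finset ℕ} {f : ℕ → ℕ} {v : Lit V}

theorem exists_explore_eq (hJ : ExhibitsJohnson F σ n b)
    (hT : IsTinhofer (modelGraph F) (modelColoring F)) (hn : 8 ≤ n) (ch : Choices V) (s : State V)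
    {ad : Lit V → Finset (Lit V)} (had : ∀ x ∈ σ, ad x ⊆ meeting σ b x 1) (hv : v ∈ σ) :
    ∃ ad', explore ch F σ s ad v = some ad' ∧ ad ≤ ad' ∧ (∀ x ∈ σ, ad' x ⊆ meeting σ b x 1) ∧
      ad' v = meeting σ b v 1 := by
  classical
  refine ⟨_, hJ.explore_eq_some hT hn hv ch s ad, ?_, fun x hx => ?_, ?_⟩
  · exact le_update_self_iff.2 Finset.subset_union_left
  · rcases eq_or_ne x v with rfl | hxv
    · rw [Function.update_self]
      exact Finset.union_subset (had x hx) subset_rfl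
    · rw [Function.update_of_ne hxv]
      exact had x hx
  · rw [Function.update_self, Finset.union_eq_right.2 (had v hv)]

theorem exists_iteration_eq_some (hJ : ExhibitsJohnson F σ n b)
    (hT : IsTinhofer (modelGraph F) (modelColoring F)) (hn : 8 ≤ n) (ch : Choices V)
    (had : ∀ x ∈ σ, s.ad x ⊆ meeting σ b x 1) (hs : LabelInvariant σ b n s D f)
    (hv : v ∈ unfinished σ s) :
    ∃ s' D' f', iteration ch F σ s v = some s' ∧ (∀ x ∈ σ, s'.ad x ⊆ meeting σ b x 1) ∧
      LabelInvariant σ b n s' D' f' ∧ D.card < D'.card := by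
  classical
  have labeling := hJ.isPairLabeling
  have hvσ : v ∈ σ := Finset.mem_of_mem_filter v hv
  obtain ⟨ad₁, explore_v, -, had₁, ad₁_v⟩ := hJ.exists_explore_eq hT hn ch s had hvσ
  have hne : (ad₁ v).Nonempty := by
    rw [ad₁_v, ← Finset.card_pos, labeling.card_meeting_one (by omega) hvσ]
    omega
  obtain ⟨w, hw⟩ : ∃ w, (ch.neighbor s (ad₁ v) hne : Lit V) = w := ⟨_, rfl⟩
  have w_mem : w ∈ meeting σ b v 1 := hw ▸ ad₁_v ▸ (ch.neighbor s (ad₁ v) hne).2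
  obtain ⟨hwσ, card_inter⟩ := mem_meeting.1 w_mem
  obtain ⟨y, hyσ, hby, i, hi, j, hj, k, hk, hbv, star_i, star_j, star_k⟩ :=
    labeling.exists_triangle hvσ w_mem
  have third_eq := hJ.thirdSingletons_eq hT (by omega) hvσ hwσ hyσ card_inter hby
  obtain ⟨ad₂, explore_w, le₂, had₂, ad₂_w⟩ := hJ.exists_explore_eq hT hn ch s had₁ hwσ
  obtain ⟨ad, explore_y, le, had, ad_y⟩ := hJ.exists_explore_eq hT hn ch s had₂ hyσ
  have ad_v : ad v = meeting σ b v 1 := (had v hvσ).antisymm (ad₁_v ▸ (le₂.trans le) v)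
  have ad_w : ad w = meeting σ b w 1 := (had w hwσ).antisymm (ad₂_w ▸ le w)
  have hs_ad : LabelInvariant σ b n { s with ad := ad } D f := { hs with }
  obtain ⟨f', hs'⟩ := hs_ad.mark_stars labeling (by omega) hi hj hk
  have card_lt : D.card < (D ∪ {i, j, k}).card := by
    refine Finset.card_lt_card (Finset.subset_union_left.ssubset_of_ne fun hD => ?_)
    refine hs.label_not_subset labeling hv (hD ▸ hbv ▸ ?_)
    grind
  refine ⟨_, _, f', iteration_eq_some explore_v hne hw explore_w third_eq explore_y
    (by rw [ad_v, ad_y, star_i]) (by rw [ad_v, ad_w, star_j]) (by rw [ad_w, ad_y, star_k]) rfl ?_,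
    ?_, hs', card_lt⟩
  · rw [hs'.vnr_eq, hs.vnr_eq]
    omega
  · simpa only [mark_ad] using had

theorem exists_mem_mainLoop (hJ : ExhibitsJohnson F σ n b)
    (hT : IsTinhofer (modelGraph F) (modelColoring F)) (hn : 8 ≤ n) (ch : Choices V)
    (had : ∀ x ∈ σ, s.ad x ⊆ meeting σ b x 1) (hs : LabelInvariant σ b n s D f) :
    ∃ s' f', some s' ∈ mainLoop ch F σ s ∧ LabelInvariant σ b n s' (Finset.Icc 1 n) f' := by
  induction hm : n - D.card using Nat.strong_induction_on generalizing s D f with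
  | _ m ih =>
  rcases (unfinished σ s).eq_empty_or_nonempty with hfin | hne
  · obtain rfl := hs.eq_Icc_of_unfinished_eq_empty hJ.isPairLabeling (by omega) hfin
    exact ⟨s, f, mem_mainLoop_of_unfinished_eq_empty hfin, hs⟩
  · obtain ⟨s₁, D₁, f₁, hs₁, had₁, inv₁, card_lt⟩ :=
      hJ.exists_iteration_eq_some hT hn ch had hs (ch.vertex s _ hne).2
    have card_le : D₁.card ≤ n := by simpa using Finset.card_le_card inv₁.subset
    obtain ⟨s', f', hs', inv'⟩ := ih _ (by omega) had₁ inv₁ rfl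
    exact ⟨s', f', mem_mainLoop_of_iteration_eq_some hne hs₁ hs', inv'⟩

end ExhibitsJohnson

end Loop

/-! ### The detection algorithm -/

section DetectJohnson

variable {V : Type u} [Fintype V] {ch : Choices V} {F : Formula V} {σ : Finset (Lit V)}

theorem verified_of_mem_detectJohnson {label : Lit V → List ℕ}
    (h : some label ∈ detectJohnson ch F σ) :
    ∃ n : ℕ, σ.card = n.choose 2 ∧ Verified F σ n label := by
  unfold detectJohnson at h
  split_ifs at h with hcard
  · obtain ⟨r, -, hr⟩ := (Part.mem_map_iff _).1 h
    obtain ⟨s, -, hs⟩ := Option.bind_eq_some_iff.1 hr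
    split_ifs at hs with verified
    obtain rfl := Option.some.inj hs
    exact ⟨_, Nat.find_spec hcard.2, verified⟩
  · simp at h

theorem mem_detectJohnson {s : State V} {n : ℕ} (hn : 8 ≤ n) (hcard : σ.card = n.choose 2)
    (hs : some s ∈ mainLoop ch F σ { label := fun _ => [], ad := fun _ => ∅, vnr := 1 })
    (verified : Verified F σ n s.label) : some s.label ∈ detectJohnson ch F σ := by
  have passes : 28 ≤ σ.card ∧ ∃ n : ℕ, σ.card = n.choose 2 :=
    ⟨hcard ▸ (by decide : 28 ≤ Nat.choose 8 2).trans (Nat.choose_le_choose 2 hn), n, hcard⟩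
  have find_eq : Nat.find passes.2 = n :=
    eq_of_choose_two_eq (by omega) ((Nat.find_spec passes.2).symm.trans hcard)
  unfold detectJohnson
  rw [dif_pos passes]
  refine (Part.mem_map_iff _).2 ⟨some s, hs, ?_⟩
  rw [Option.bind_some, find_eq, if_pos verified]

theorem ExhibitsJohnson.exists_mem_detectJohnson {n : ℕ} {b : Lit V → Finset ℕ}
    (hJ : ExhibitsJohnson F σ n b) (hT : IsTinhofer (modelGraph F) (modelColoring F))
    (hn : 8 ≤ n) (ch : Choices V) :
    ∃ label : Lit V → List ℕ, some label ∈ detectJohnson ch F σ ∧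
      ∃ τ ∈ symGroup n, ∀ l ∈ σ, labelSet label l = (b l).image τ := by
  have init : LabelInvariant σ b n { label := fun _ => [], ad := fun _ => ∅, vnr := 1 } ∅ id := by
    constructor <;> simp
  obtain ⟨s, f, hs, inv⟩ := hJ.exists_mem_mainLoop hT hn ch (by simp) init
  obtain ⟨τ, hτ, hlabel⟩ := inv.exists_perm hJ.isPairLabeling
  have verified := hJ.verified (hJ.neg_notMem (by omega)) hτ hlabel
  exact ⟨s.label, mem_detectJohnson hn hJ.isPairLabeling.card_eq hs verified, τ, hτ, hlabel⟩

end DetectJohnson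

end JohnsonSym

theorem mainTheorem3 {V : Type*} [Fintype V] (F : Formula V) (σ : Finset (Lit V))
    (ch : Choices V) :
    -- (1) every returned labeling yields symmetries of `F`
    ((∀ l ∈ σ, neg l ∉ σ) →
      ∀ label : Lit V → List ℕ, some label ∈ detectJohnson ch F σ →
        ∃ n : ℕ, σ.card = n.choose 2 ∧
          Set.BijOn (labelSet label) (σ : Set (Lit V)) (twoSubsets n : Set (Finset ℕ)) ∧
          ∀ τ ∈ symGroup n, IsSymmetry F (expand (inducedPerm σ (labelSet label) τ))) ∧
    -- (2) Johnson symmetry is detected if the model graph is Tinhofer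
    (∀ (n : ℕ) (b : Lit V → Finset ℕ), 8 ≤ n → ExhibitsJohnson F σ n b →
      IsTinhofer (modelGraph F) (modelColoring F) →
        ∃ label : Lit V → List ℕ, some label ∈ detectJohnson ch F σ ∧
          ∃ τ ∈ symGroup n, ∀ l ∈ σ, labelSet label l = (b l).image τ) := by
  refine ⟨fun hσ label h => ?_, fun n b hn hJ hT => hJ.exists_mem_detectJohnson hT hn ch⟩
  obtain ⟨n, hcard, hbij, hswap⟩ := verified_of_mem_detectJohnson h
  exact ⟨n, hcard, hbij, fun τ hτ => isSymmetry_expand_of_swap_succ hbij hσ hswap hτ⟩
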